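/- Let $k$ be a field. All DG algebras are unital, associative and $\mathbb{Z}$-graded over $k$, with differential of degree $+1$, and modules are right DG modules. For a DG algebra $A$ let $D(A)$ be the unbounded derived category of $A$, i.e. the Verdier quotient of the homotopy category of right DG $A$-modules by the acyclic ones, and let $\mathrm{Perf}(A)\subset D(A)$ be the smallest strictly full triangulated subcategory that contains $A$ and is closed under direct summands. Let $A$ and $B$ be DG algebras over $k$, and let $\pi^*: D(A)\rightleftarrows D(B):\pi_*$ be an adjoint pair of triangulated functors ($\pi^*$ left adjoint to $\pi_*$) such that 1. $\pi_*\circ\pi^*\simeq \mathrm{id}_{D(A)}$; 2. both $\pi_*$ and $\pi^*$ commute with arbitrary (small) direct sums; 3. for all $E\in\mathrm{Perf}(A)$ and $F\in\mathrm{Perf}(B)$ the $k$-vector space $\bigoplus_{n\in\mathbb{Z}}\mathrm{Hom}_{D(B)}(\pi^*E,F[n])$ is finite dimensional. Put $T:=\pi^*A\in D(B)$ and $\widetilde A:=R\mathrm{Hom}_B(T,T)$. Here $R\mathrm{Hom}_B(T,-)$ is computed with an h-projective DG $B$-module $P$ isomorphic to $T$ in $D(B)$ (h-projective: the complex $\mathrm{Hom}_B(P,M)$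 is acyclic for every acyclic $M$); such a $P$ exists. For any such $P$, $\widetilde A$ is the DG algebra $\mathrm{End}_B(P)$, and $R\mathrm{Hom}_B(T,-): D(B)\to D(\widetilde A)$ is the triangulated functor induced by $M\mapsto \mathrm{Hom}_B(P,M)$, on which $\mathrm{End}_B(P)$ acts on the right by composition. Then, for every choice of $P$, the composition $$\phi:\; D(A)\xrightarrow{\ \pi^*\ } D(B)\xrightarrow{\ R\mathrm{Hom}_B(T,-)\ } D(\widetilde A)$$ is a triangulated equivalence. -/

import Mathlib

open CategoryTheory Limits Pretriangulated
open scoped RightActions DirectSum ZeroObject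

universe u

noncomputable section

/-- The sign `(-1)^i`. -/
def sgn (i : ℤ) : ℤ := (i.negOnePow : ℤˣ)

theorem sgn_add (i j : ℤ) : sgn (i + j) = sgn i * sgn j := by
  simp [sgn, Int.negOnePow_add]

theorem sgn_zero : sgn 0 = 1 := by simp [sgn]

theorem sgn_one : sgn 1 = -1 := by simp [sgn]

theorem sgn_mul_self (i : ℤ) : sgn i * sgn i = 1 := by
  rw [sgn, ← Units.val_mul, Int.units_mul_self]; rfl

theorem sgn_smul_smul {V : Type*} [AddCommGroup V] (i : ℤ) (v : V) : sgn i • sgn i • v = v := by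
  rw [smul_smul, sgn_mul_self, one_smul]

section Graded

variable {k : Type u} [CommRing k] {V : Type u} [AddCommGroup V] [Module k V]
  {gr : ℤ → Submodule k V}

/-- A property of the elements of a graded module that is stable under addition holds as soon as
it holds for homogeneous elements. -/
@[elab_as_elim]
theorem graded_induction (h : DirectSum.IsInternal gr) {p : V → Prop}
    (hom : ∀ i, ∀ v ∈ gr i, p v) (add : ∀ v w, p v → p w → p (v + w)) (v : V) : p v := by
  have hv : v ∈ ⨆ i, gr i := by rw [h.submodule_iSup_eq_top]; trivial
  exact Submodule.iSup_induction gr (motive := p) hv hom (hom 0 0 (zero_mem _)) add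

/-- The decomposition of a graded module as a direct sum. -/
def gradedEquiv (h : DirectSum.IsInternal gr) : V ≃ₗ[k] ⨁ i, gr i :=
  (LinearEquiv.ofBijective (DirectSum.coeLinearMap gr)
    (show Function.Bijective (DirectSum.coeLinearMap gr) from h)).symm

/-- The projection of a graded module onto its component of degree `i`. -/
def gradedProj (h : DirectSum.IsInternal gr) (i : ℤ) : V →ₗ[k] V :=
  (gr i).subtype ∘ₗ DirectSum.component k ℤ (fun i => gr i) i ∘ₗ
    (gradedEquiv h).toLinearMap

theorem gradedEquiv_of_mem (h : DirectSum.IsInternal gr) {i : ℤ} {v : V} (hv : v ∈ gr i) :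
    gradedEquiv h v = DirectSum.lof k ℤ (fun i => gr i) i ⟨v, hv⟩ := by
  rw [gradedEquiv, LinearEquiv.symm_apply_eq]
  exact (DirectSum.coeLinearMap_lof gr i ⟨v, hv⟩).symm

theorem gradedProj_of_mem (h : DirectSum.IsInternal gr) {i : ℤ} {v : V} (hv : v ∈ gr i) :
    gradedProj h i v = v := by
  simp [gradedProj, gradedEquiv_of_mem h hv, DirectSum.component.lof_self]

theorem gradedProj_of_mem_ne (h : DirectSum.IsInternal gr) {i j : ℤ} (hij : j ≠ i) {v : V}
    (hv : v ∈ gr j) : gradedProj h i v = 0 := by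
  simp [gradedProj, gradedEquiv_of_mem h hv, DirectSum.component.of, hij]

/-- The operator which multiplies the component of degree `i` by `(-1)^i`. -/
def signOp (h : DirectSum.IsInternal gr) : V →ₗ[k] V :=
  DirectSum.toModule k ℤ V (fun i => sgn i • (gr i).subtype) ∘ₗ
    (gradedEquiv h).toLinearMap

theorem signOp_of_mem (h : DirectSum.IsInternal gr) {i : ℤ} {v : V} (hv : v ∈ gr i) :
    signOp h v = sgn i • v := by
  simp [signOp, gradedEquiv_of_mem h hv]

theorem signOp_signOp (h : DirectSum.IsInternal gr) (v : V) : signOp h (signOp h v) = v := by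
  refine graded_induction h (p := fun v => signOp h (signOp h v) = v)
    (fun i v hv => ?_) (fun v w hv hw => ?_) v
  · rw [signOp_of_mem h hv, map_zsmul, signOp_of_mem h hv, sgn_smul_smul]
  · simp [hv, hw]

/-- A criterion for submodules to be the components of a grading. -/
theorem isInternal_of_separating {W : Type u} [AddCommGroup W] [Module k W] {T : Type*}
    (hsup : ∀ v, v ∈ ⨆ i, gr i) (p : T → ℤ → V →ₗ[k] W)
    (h₁ : ∀ i, ∀ v ∈ gr i, (∀ t, p t i v = 0) → v = 0)
    (h₂ : ∀ t i j, j ≠ i → ∀ v ∈ gr j, p t i v = 0) : DirectSum.IsInternal gr := by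
  rw [DirectSum.isInternal_submodule_iff_iSupIndep_and_iSup_eq_top]
  refine ⟨?_, by rw [eq_top_iff]; exact fun v _ => hsup v⟩
  rw [iSupIndep_def]
  intro i
  rw [Submodule.disjoint_def]
  intro v hv hv'
  refine h₁ i v hv fun t => ?_
  have : (⨆ j, ⨆ (_ : j ≠ i), gr j) ≤ LinearMap.ker (p t i) :=
    iSup_le fun j => iSup_le fun hj w hw => h₂ t i j hj w hw
  exact this hv'

end Graded

/-- A differential graded (unital, associative) algebra over `k`, with a differential of degree
`+1`. The underlying algebra is the direct sum of its homogeneous components `gr i`. -/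
structure DGAlgebra (k : Type u) [CommRing k] where
  carrier : Type u
  [ring : Ring carrier]
  [algebra : Algebra k carrier]
  gr : ℤ → Submodule k carrier
  isInternal : DirectSum.IsInternal gr
  one_mem : 1 ∈ gr 0
  mul_mem : ∀ {i j : ℤ} {a b : carrier}, a ∈ gr i → b ∈ gr j → a * b ∈ gr (i + j)
  d : carrier →ₗ[k] carrier
  d_mem : ∀ {i : ℤ} {a : carrier}, a ∈ gr i → d a ∈ gr (i + 1)
  d_d : ∀ a, d (d a) = 0
  leibniz : ∀ {i : ℤ} {a : carrier}, a ∈ gr i → ∀ b, d (a * b) = d a * b + sgn i • (a * d b)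

instance (k : Type u) [CommRing k] : CoeSort (DGAlgebra k) (Type u) := ⟨DGAlgebra.carrier⟩

attribute [instance] DGAlgebra.ring DGAlgebra.algebra

/-- A right differential graded module over the DG algebra `A`. The underlying module is the
direct sum of its homogeneous components `gr i`, and `m <• a` is the right action. -/
structure DGModule {k : Type u} [CommRing k] (A : DGAlgebra k) where
  carrier : Type u
  [addCommGroup : AddCommGroup carrier]
  [module : Module k carrier]
  [rightModule : Module Aᵐᵒᵖ carrier]
  [isScalarTower : IsScalarTower k Aᵐᵒᵖ carrier]
  gr : ℤ → Submodule k carrier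
  isInternal : DirectSum.IsInternal gr
  smul_mem : ∀ {i j : ℤ} {m : carrier} {a : A}, m ∈ gr i → a ∈ A.gr j → m <• a ∈ gr (i + j)
  d : carrier →ₗ[k] carrier
  d_mem : ∀ {i : ℤ} {m : carrier}, m ∈ gr i → d m ∈ gr (i + 1)
  d_d : ∀ m, d (d m) = 0
  leibniz : ∀ {i : ℤ} {m : carrier}, m ∈ gr i → ∀ a : A,
    d (m <• a) = d m <• a + sgn i • (m <• A.d a)

instance {k : Type u} [CommRing k] (A : DGAlgebra k) : CoeSort (DGModule A) (Type u) :=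
  ⟨DGModule.carrier⟩

attribute [instance] DGModule.addCommGroup DGModule.module DGModule.rightModule
  DGModule.isScalarTower

namespace DGModule

variable {k : Type u} [CommRing k] {A : DGAlgebra k}

/-- Morphisms of DG modules: `A`-linear maps of degree zero that commute with the
differentials. -/
@[ext]
structure Hom (M N : DGModule A) where
  lin : M →ₗ[Aᵐᵒᵖ] N
  map_mem : ∀ {i : ℤ} {m : M}, m ∈ M.gr i → lin m ∈ N.gr i
  comm : ∀ m, lin (M.d m) = N.d (lin m)

instance (M : DGModule A) : SMulCommClass Aᵐᵒᵖ k M := IsScalarTower.to_smulCommClass'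

instance : Category (DGModule A) where
  Hom M N := Hom M N
  id M := ⟨LinearMap.id, fun h => h, fun _ => rfl⟩
  comp f g := ⟨g.lin ∘ₗ f.lin, fun h => g.map_mem (f.map_mem h), fun m => by
    simp [f.comm, g.comm]⟩

theorem linComp {M N P : DGModule A} (f : M ⟶ N) (g : N ⟶ P) (m : M) :
    (f ≫ g).lin m = g.lin (f.lin m) := rfl

theorem linId {M : DGModule A} (m : M) : Hom.lin (𝟙 M) m = m := rfl

theorem hom_ext {M N : DGModule A} {f g : M ⟶ N} (h : ∀ m, f.lin m = g.lin m) : f = g :=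
  Hom.ext (LinearMap.ext h)

theorem lin_mem {M N : DGModule A} (f : M ⟶ N) {i : ℤ} {m : M} (h : m ∈ M.gr i) :
    f.lin m ∈ N.gr i := f.map_mem h

theorem lin_d {M N : DGModule A} (f : M ⟶ N) (m : M) : f.lin (M.d m) = N.d (f.lin m) := f.comm m

section Linear

variable (M N : DGModule A)

/-- The `k`-submodule of the morphisms of DG modules in the module of all `A`-linear maps. -/
def homSubmodule : Submodule k (M →ₗ[Aᵐᵒᵖ] N) where
  carrier := {f | (∀ (i : ℤ) (m : M), m ∈ M.gr i → f m ∈ N.gr i) ∧ ∀ m, f (M.d m) = N.d (f m)}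
  zero_mem' := ⟨fun _ _ _ => zero_mem _, fun _ => by simp⟩
  add_mem' hf hg := ⟨fun i m hm => add_mem (hf.1 i m hm) (hg.1 i m hm), fun m => by
    simp [hf.2, hg.2]⟩
  smul_mem' c f hf := ⟨fun i m hm => Submodule.smul_mem _ _ (hf.1 i m hm), fun m => by
    simp [hf.2]⟩

/-- Morphisms of DG modules as elements of a submodule. -/
def homEquiv : (M ⟶ N) ≃ homSubmodule M N where
  toFun f := ⟨f.lin, fun _ _ => f.map_mem, f.comm⟩
  invFun f := ⟨f.1, fun {i m} => f.2.1 i m, f.2.2⟩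
  left_inv _ := rfl
  right_inv _ := rfl

instance : AddCommGroup (M ⟶ N) := (homEquiv M N).addCommGroup

instance : Module k (M ⟶ N) := (homEquiv M N).module k

end Linear

@[simp] theorem lin_add {M N : DGModule A} (f g : M ⟶ N) (m : M) :
    (f + g).lin m = f.lin m + g.lin m := rfl
@[simp] theorem lin_sub {M N : DGModule A} (f g : M ⟶ N) (m : M) :
    (f - g).lin m = f.lin m - g.lin m := rfl
@[simp] theorem lin_neg {M N : DGModule A} (f : M ⟶ N) (m : M) :
    (-f).lin m = - f.lin m := rfl
@[simp] theorem lin_zero {M N : DGModule A} (m : M) : (0 : M ⟶ N).lin m = 0 := rfl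
@[simp] theorem lin_smul {M N : DGModule A} (c : k) (f : M ⟶ N) (m : M) :
    (c • f).lin m = c • f.lin m := rfl

instance : Preadditive (DGModule A) where
  add_comp _ _ _ f g h := hom_ext fun m => by simp [linComp]
  comp_add _ _ _ f g h := hom_ext fun m => by simp [linComp]

instance : Linear k (DGModule A) where
  smul_comp _ _ _ c f g := hom_ext fun m => by
    rw [linComp, lin_smul, lin_smul, linComp]
    exact LinearMap.map_smul_of_tower g.lin c _
  comp_smul _ _ _ f c g := hom_ext fun m => by simp [linComp]

/-- The zero DG module. -/
def zeroModule : DGModule A where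
  carrier := PUnit
  gr _ := ⊤
  isInternal := isInternal_of_separating (T := Unit) (W := PUnit) (by simp)
    (fun _ _ => 0) (fun _ _ _ _ => rfl) (fun _ _ _ _ _ _ => rfl)
  smul_mem _ _ := trivial
  d := 0
  d_mem _ := trivial
  d_d _ := rfl
  leibniz _ _ := rfl

theorem isZero_zeroModule : IsZero (zeroModule : DGModule A) := by
  rw [IsZero.iff_id_eq_zero]; rfl

instance : HasZeroObject (DGModule A) := ⟨_, isZero_zeroModule⟩

/-- The shift `M[n]`: the component of degree `i` of `M[n]` is that of degree `i + n` of `M`, the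
differential is multiplied by `(-1)^n`, the right action of `A` is unchanged. -/
def shiftObj (M : DGModule A) (n : ℤ) : DGModule A where
  carrier := M.carrier
  gr i := M.gr (i + n)
  isInternal := isInternal_of_separating (T := Unit)
    (fun v => graded_induction M.isInternal (fun i v hv => by
      have : v ∈ M.gr ((i - n) + n) := by simpa using hv
      exact Submodule.mem_iSup_of_mem (p := fun i => M.gr (i + n)) (i - n) this)
      (fun v w => add_mem) v)
    (fun _ i => gradedProj M.isInternal (i + n))
    (fun i v hv h => by rw [← h ⟨⟩, gradedProj_of_mem _ hv])
    (fun _ i j hij v hv => gradedProj_of_mem_ne _ (by omega) hv)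
  smul_mem {i j m a} hm ha := by
    have := M.smul_mem hm ha
    rwa [show i + n + j = i + j + n by ring] at this
  d := sgn n • M.d
  d_mem {i m} hm := by
    have := M.d_mem hm
    rw [show i + n + 1 = i + 1 + n by ring] at this
    exact zsmul_mem this _
  d_d m := by simp only [LinearMap.smul_apply, map_zsmul, M.d_d, smul_zero]
  leibniz {i m} hm a := by
    simp only [LinearMap.smul_apply, M.leibniz hm, smul_add, sgn_add]
    congr 1
    · exact (smul_comm _ _ _)
    · rw [smul_smul, ← mul_assoc, mul_comm, ← mul_assoc, sgn_mul_self, one_mul]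

/-- The shift of a morphism: the same underlying map. -/
def shiftMap {M N : DGModule A} (f : M ⟶ N) (n : ℤ) : shiftObj M n ⟶ shiftObj N n where
  lin := f.lin
  map_mem h := f.map_mem h
  comm m := (f.lin.toAddMonoidHom.map_zsmul _ _).trans (congrArg (sgn n • ·) (f.comm m))

/-- The shift functor. -/
def shiftF (n : ℤ) : DGModule A ⥤ DGModule A where
  obj M := shiftObj M n
  map f := shiftMap f n

/-- An isomorphism of DG modules given by the identity map. -/
def isoOfEq (M N : DGModule A) (e : M ≃ₗ[Aᵐᵒᵖ] N)
    (h : ∀ i m, m ∈ M.gr i ↔ e m ∈ N.gr i) (hd : ∀ m, e (M.d m) = N.d (e m)) : M ≅ N where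
  hom := ⟨e.toLinearMap, fun {i m} hm => (h i m).1 hm, hd⟩
  inv := ⟨e.symm.toLinearMap, fun {i m} hm => (h i _).2 (by simpa using hm), fun m => by
    apply e.injective; simp [hd]⟩
  hom_inv_id := hom_ext fun m => e.symm_apply_apply m
  inv_hom_id := hom_ext fun m => e.apply_symm_apply m

/-- `M[0] ≅ M`, by the identity map. -/
def shiftZeroIso (M : DGModule A) : shiftObj M 0 ≅ M :=
  isoOfEq (shiftObj M 0) M (LinearEquiv.refl Aᵐᵒᵖ M)
    (fun i m => by
      change m ∈ M.gr (i + 0) ↔ m ∈ M.gr i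
      rw [add_zero])
    (fun m => by
      change sgn 0 • M.d m = M.d m
      rw [sgn_zero, one_smul])

/-- `M[n + m] ≅ M[n][m]`, by the identity map. -/
def shiftAddIso (M : DGModule A) (n m : ℤ) :
    shiftObj M (n + m) ≅ shiftObj (shiftObj M n) m :=
  isoOfEq (shiftObj M (n + m)) (shiftObj (shiftObj M n) m) (LinearEquiv.refl Aᵐᵒᵖ M)
    (fun i x => by
      change x ∈ M.gr (i + (n + m)) ↔ x ∈ M.gr (i + m + n)
      rw [show i + (n + m) = i + m + n by ring])
    (fun x => by
      change sgn (n + m) • M.d x = sgn m • sgn n • M.d x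
      rw [smul_smul, add_comm, sgn_add])

theorem eqToHom_lin (M : DGModule A) {a b : ℤ} (hab : a = b)
    (h : shiftObj M a = shiftObj M b) (m : M) :
    Hom.lin (eqToHom h) (m : shiftObj M a) = (m : shiftObj M b) := by
  subst hab; rfl

instance : HasShift (DGModule A) ℤ := hasShiftMk _ _
  { F := shiftF
    zero := NatIso.ofComponents shiftZeroIso (fun _ => rfl)
    add := fun n m => NatIso.ofComponents (fun M => shiftAddIso M n m) (fun _ => rfl)
    assoc_hom_app := fun a b c M => hom_ext fun m =>
      (eqToHom_lin M (add_assoc a b c) _ m).symm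
    zero_add_hom_app := fun n M => hom_ext fun m =>
      (eqToHom_lin M (zero_add n) _ m).symm
    add_zero_hom_app := fun n M => hom_ext fun m =>
      (eqToHom_lin M (add_zero n) _ m).symm }

instance (n : ℤ) : (shiftFunctor (DGModule A) n).Additive where
  map_add := rfl

instance (n : ℤ) : (shiftFunctor (DGModule A) n).Linear k where
  map_smul _ _ := rfl

/-- The zero-homotopy relation: `f - g = d h + h d` for an `A`-linear map `h` of degree `-1`. -/
def homotopic (A : DGAlgebra k) : HomRel (DGModule A) := fun M N f g =>
  ∃ h : M →ₗ[Aᵐᵒᵖ] N, (∀ i, ∀ m ∈ M.gr i, h m ∈ N.gr (i - 1)) ∧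
    ∀ m, f.lin m - g.lin m = N.d (h m) + h (M.d m)

instance : Congruence (homotopic A) where
  equivalence :=
    { refl := fun f => ⟨0, fun _ _ _ => zero_mem _, fun m => by simp⟩
      symm := by
        rintro f g ⟨h, h₁, h₂⟩
        exact ⟨-h, fun i m hm => neg_mem (h₁ i m hm), fun m => by
          rw [← neg_sub, h₂]; simp [add_comm]⟩
      trans := by
        rintro f g e ⟨h, h₁, h₂⟩ ⟨h', h₁', h₂'⟩
        exact ⟨h + h', fun i m hm => add_mem (h₁ i m hm) (h₁' i m hm), fun m => by
          rw [← sub_add_sub_cancel _ (g.lin m), h₂, h₂']; simp; abel⟩ }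
  comp_left := by
    rintro X Y Z f g g' ⟨h, h₁, h₂⟩
    exact ⟨h ∘ₗ f.lin, fun i m hm => h₁ i _ (lin_mem f hm), fun m => by
      simp [linComp, h₂, lin_d]⟩
  comp_right := by
    rintro X Y Z f f' g ⟨h, h₁, h₂⟩
    exact ⟨g.lin ∘ₗ h, fun i m hm => lin_mem g (h₁ i _ hm), fun m => by
      simp [linComp, ← map_sub, h₂, lin_d]⟩

theorem homotopic_add ⦃M N : DGModule A⦄ (f₁ f₂ g₁ g₂ : M ⟶ N) (hf : homotopic A f₁ f₂)
    (hg : homotopic A g₁ g₂) : homotopic A (f₁ + g₁) (f₂ + g₂) := by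
  obtain ⟨h, h₁, h₂⟩ := hf
  obtain ⟨h', h₁', h₂'⟩ := hg
  exact ⟨h + h', fun i m hm => add_mem (h₁ i m hm) (h₁' i m hm), fun m => by
    rw [lin_add, lin_add, add_sub_add_comm, h₂, h₂']; simp; abel⟩

theorem homotopic_smul (c : k) ⦃M N : DGModule A⦄ (f₁ f₂ : M ⟶ N) (hf : homotopic A f₁ f₂) :
    homotopic A (c • f₁) (c • f₂) := by
  obtain ⟨h, h₁, h₂⟩ := hf
  exact ⟨c • h, fun i m hm => Submodule.smul_mem _ _ (h₁ i m hm), fun m => by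
    rw [lin_smul, lin_smul, ← smul_sub, h₂]; simp⟩

instance : (homotopic A).IsCompatibleWithShift ℤ where
  condition n M N f g := by
    rintro ⟨h, h₁, h₂⟩
    refine ⟨(sgn n • h : M →ₗ[Aᵐᵒᵖ] N), fun i m hm => ?_, fun m => ?_⟩
    · have := h₁ (i + n) m hm
      rw [show i + n - 1 = i - 1 + n by ring] at this
      exact zsmul_mem this _
    · refine (h₂ m).trans ?_
      change _ = sgn n • N.d (sgn n • h m) + sgn n • h (sgn n • M.d m)
      rw [map_zsmul, map_zsmul, sgn_smul_smul, sgn_smul_smul]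

end DGModule

open DGModule

variable {k : Type u} [CommRing k]

/-- The homotopy category of right DG modules over `A`. -/
abbrev HomotopyCat (A : DGAlgebra k) := CategoryTheory.Quotient (homotopic A)

variable {A : DGAlgebra k}

instance : Preadditive (HomotopyCat A) := CategoryTheory.Quotient.preadditive _ homotopic_add

variable (A) in
/-- The functor from DG modules to the homotopy category. -/
abbrev toK : DGModule A ⥤ HomotopyCat A := CategoryTheory.Quotient.functor (homotopic A)

instance : (toK A).Additive := CategoryTheory.Quotient.functor_additive _ homotopic_add

instance : Linear k (HomotopyCat A) := CategoryTheory.Quotient.linear k _ homotopic_smul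

instance : (toK A).Linear k := CategoryTheory.Quotient.linear_functor k _ homotopic_smul

instance : HasZeroObject (HomotopyCat A) := (toK A).hasZeroObject_of_additive

instance (n : ℤ) : (shiftFunctor (HomotopyCat A) n).Additive := by
  have : (toK A ⋙ shiftFunctor _ n).Additive :=
    Functor.additive_of_iso ((toK A).commShiftIso n)
  exact Functor.additive_of_full_essSurj_comp (toK A) _

theorem toK_eq {M N : DGModule A} {f g : M ⟶ N} (h : homotopic A f g) :
    (toK A).map f = (toK A).map g := CategoryTheory.Quotient.sound _ h

/-- The isomorphism in the homotopy category given by a homotopy equivalence. -/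
def isoK {M N : DGModule A} (u : M ⟶ N) (v : N ⟶ M) (h : homotopic A (u ≫ v) (𝟙 M))
    (h' : homotopic A (v ≫ u) (𝟙 N)) : (toK A).obj M ≅ (toK A).obj N where
  hom := (toK A).map u
  inv := (toK A).map v
  hom_inv_id := by rw [← Functor.map_comp, toK_eq h, CategoryTheory.Functor.map_id]
  inv_hom_id := by rw [← Functor.map_comp, toK_eq h', CategoryTheory.Functor.map_id]

namespace DGModule

/-- The mapping cone of `f : M ⟶ N`: it is `M[1] ⊕ N` with the differential
`(x, y) ↦ (- d x, f x + d y)`. -/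
def cone {M N : DGModule A} (f : M ⟶ N) : DGModule A where
  carrier := M × N
  gr i := (M.gr (i + 1)).prod (N.gr i)
  isInternal := isInternal_of_separating (T := Unit)
    (fun v => by
      have h₁ : ∀ x : M, ((x, 0) : M × N) ∈ ⨆ i, (M.gr (i + 1)).prod (N.gr i) := fun x =>
        graded_induction M.isInternal
          (p := fun x => ((x, 0) : M × N) ∈ ⨆ i, (M.gr (i + 1)).prod (N.gr i))
          (fun i v hv => Submodule.mem_iSup_of_mem (i - 1) ⟨by simpa using hv, zero_mem _⟩)
          (fun v w hv hw => by simpa using add_mem hv hw) x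
      have h₂ : ∀ x : N, ((0, x) : M × N) ∈ ⨆ i, (M.gr (i + 1)).prod (N.gr i) := fun x =>
        graded_induction N.isInternal
          (p := fun x => ((0, x) : M × N) ∈ ⨆ i, (M.gr (i + 1)).prod (N.gr i))
          (fun i v hv => Submodule.mem_iSup_of_mem i ⟨zero_mem _, hv⟩)
          (fun v w hv hw => by simpa using add_mem hv hw) x
      simpa using add_mem (h₁ v.1) (h₂ v.2))
    (fun _ i => (gradedProj M.isInternal (i + 1)).prodMap (gradedProj N.isInternal i))
    (fun i v hv h => by
      rw [← h ⟨⟩, LinearMap.prodMap_apply, gradedProj_of_mem _ hv.1, gradedProj_of_mem _ hv.2])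
    (fun _ i j hij v hv => by
      rw [LinearMap.prodMap_apply, gradedProj_of_mem_ne _ (by omega) hv.1,
        gradedProj_of_mem_ne _ hij hv.2]; rfl)
  smul_mem {i j m a} hm ha := ⟨by
    have := M.smul_mem hm.1 ha
    rwa [show i + 1 + j = i + j + 1 by ring] at this, N.smul_mem hm.2 ha⟩
  d :=
    { toFun := fun v => (- M.d v.1, f.lin v.1 + N.d v.2)
      map_add' := fun v w => by
        ext
        · simp; abel
        · simp; abel
      map_smul' := fun c v => by
        ext
        · simp
        · simp [LinearMap.map_smul_of_tower] }
  d_mem hm := ⟨neg_mem (M.d_mem hm.1), add_mem (lin_mem f hm.1) (N.d_mem hm.2)⟩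
  d_d v := by
    ext
    · simp [M.d_d]
    · simp [N.d_d, lin_d]
  leibniz {i m} hm a := by
    ext
    · simp [M.leibniz hm.1, sgn_add, sgn_one, add_comm]
    · simp [N.leibniz hm.2, add_assoc]

theorem cone_d {M N : DGModule A} (f : M ⟶ N) (v : M × N) :
    (cone f).d v = ((- M.d v.1, f.lin v.1 + N.d v.2) : M × N) := rfl

theorem shift_d (M : DGModule A) (m : M) : (M⟦(1 : ℤ)⟧).d m = - M.d m := by
  change sgn 1 • M.d m = _
  rw [sgn_one, neg_one_smul]

/-- The inclusion of the target in the mapping cone. -/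
def coneIn {M N : DGModule A} (f : M ⟶ N) : N ⟶ cone f where
  lin := LinearMap.inr Aᵐᵒᵖ M N
  map_mem h := ⟨zero_mem _, h⟩
  comm m := by
    refine Prod.ext ?_ ?_
    · change (0 : M) = - M.d 0
      simp
    · change N.d m = f.lin 0 + N.d m
      simp

/-- The projection of the mapping cone onto the shift of the source. -/
def coneOut {M N : DGModule A} (f : M ⟶ N) : cone f ⟶ M⟦(1 : ℤ)⟧ where
  lin := LinearMap.fst Aᵐᵒᵖ M N
  map_mem h := h.1
  comm m := by
    change - M.d m.1 = sgn 1 • M.d m.1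
    rw [sgn_one, neg_one_smul]

/-- The standard triangle `M ⟶ N ⟶ cone f ⟶ M[1]`. -/
def coneTriangle {M N : DGModule A} (f : M ⟶ N) : Triangle (DGModule A) :=
  Triangle.mk f (coneIn f) (coneOut f)

/-- The map of mapping cones given by a square that commutes up to a homotopy `h`. -/
def coneMap {M N M' N' : DGModule A} (f : M ⟶ N) (f' : M' ⟶ N') (a : M ⟶ M') (b : N ⟶ N')
    (h : M →ₗ[Aᵐᵒᵖ] N') (h₁ : ∀ i, ∀ m ∈ M.gr i, h m ∈ N'.gr (i - 1))
    (h₂ : ∀ m, (f ≫ b).lin m - (a ≫ f').lin m = N'.d (h m) + h (M.d m)) :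
    cone f ⟶ cone f' where
  lin := LinearMap.prod (a.lin ∘ₗ LinearMap.fst Aᵐᵒᵖ M N)
    (h ∘ₗ LinearMap.fst Aᵐᵒᵖ M N + b.lin ∘ₗ LinearMap.snd Aᵐᵒᵖ M N)
  map_mem {i m} hm := ⟨lin_mem a hm.1, add_mem (by
    have := h₁ _ _ hm.1
    rwa [add_sub_cancel_right] at this) (lin_mem b hm.2)⟩
  comm m := by
    have := h₂ m.1
    rw [linComp, linComp] at this
    refine Prod.ext ?_ ?_
    · change a.lin (- M.d m.1) = - M'.d (a.lin m.1)
      rw [map_neg, lin_d]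
    · change h (-M.d m.1) + b.lin (f.lin m.1 + N.d m.2) =
        f'.lin (a.lin m.1) + N'.d (h m.1 + b.lin m.2)
      rw [map_neg, map_add, map_add, lin_d, sub_eq_iff_eq_add.1 this]
      abel

end DGModule

theorem homotopic_of_lin {M N : DGModule A} {f g : M ⟶ N} (h : ∀ m, f.lin m = g.lin m) :
    homotopic A f g :=
  ⟨0, fun _ _ _ => zero_mem _, fun m => by simp [h]⟩

theorem homotopic_symm {M N : DGModule A} {f g : M ⟶ N} (h : homotopic A f g) :
    homotopic A g f := Congruence.equivalence.symm h

/-- A criterion for the images of two triangles of DG modules in the homotopy category to be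
isomorphic. -/
def mapTriangleIsoK {T T' : Triangle (DGModule A)} (e₁ : T.obj₁ ≅ T'.obj₁) (e₂ : T.obj₂ ≅ T'.obj₂)
    (e₃ : (toK A).obj T.obj₃ ≅ (toK A).obj T'.obj₃) (u : T.obj₃ ⟶ T'.obj₃)
    (hu : (toK A).map u = e₃.hom) (h₁ : T.mor₁ ≫ e₂.hom = e₁.hom ≫ T'.mor₁)
    (h₂ : homotopic A (T.mor₂ ≫ u) (e₂.hom ≫ T'.mor₂))
    (h₃ : homotopic A (T.mor₃ ≫ e₁.hom⟦(1 : ℤ)⟧') (u ≫ T'.mor₃)) :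
    (toK A).mapTriangle.obj T ≅ (toK A).mapTriangle.obj T' :=
  Triangle.isoMk _ _ ((toK A).mapIso e₁) ((toK A).mapIso e₂) e₃
    (by
      change (toK A).map _ ≫ (toK A).map _ = (toK A).map _ ≫ (toK A).map _
      rw [← Functor.map_comp, ← Functor.map_comp, h₁])
    (by
      change (toK A).map _ ≫ _ = (toK A).map _ ≫ (toK A).map _
      rw [← hu, ← Functor.map_comp, ← Functor.map_comp, toK_eq h₂])
    (by
      change ((toK A).map _ ≫ _) ≫ ((toK A).map e₁.hom)⟦(1 : ℤ)⟧' = _ ≫ (toK A).map _ ≫ _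
      have := ((toK A).commShiftIso (1 : ℤ)).hom.naturality e₁.hom
      rw [← hu, Category.assoc, ← Functor.comp_map, ← this, ← Category.assoc, ← Category.assoc,
        Functor.comp_map, ← Functor.map_comp, ← Functor.map_comp, toK_eq h₃])

variable (A) in
/-- The distinguished triangles of the homotopy category are those isomorphic to a standard
triangle. -/
def distK : Set (Triangle (HomotopyCat A)) :=
  {T | ∃ (M N : DGModule A) (f : M ⟶ N),
    Nonempty (T ≅ (toK A).mapTriangle.obj (coneTriangle f))}

theorem distK_of_iso {T T' : Triangle (HomotopyCat A)} (h : T ∈ distK A) (e : T' ≅ T) :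
    T' ∈ distK A := by
  obtain ⟨M, N, f, ⟨e'⟩⟩ := h
  exact ⟨M, N, f, ⟨e ≪≫ e'⟩⟩

theorem distK_contractible (X : HomotopyCat A) : contractibleTriangle X ∈ distK A := by
  obtain ⟨M⟩ := X
  let c := cone (𝟙 M)
  let h : c →ₗ[Aᵐᵒᵖ] c := LinearMap.inl Aᵐᵒᵖ M M ∘ₗ LinearMap.snd Aᵐᵒᵖ M M
  have hc : IsZero ((toK A).obj c) := by
    rw [IsZero.iff_id_eq_zero, ← CategoryTheory.Functor.map_id, ← Functor.map_zero]
    refine toK_eq ⟨h, fun i m hm => ⟨?_, zero_mem _⟩, fun m => Prod.ext ?_ ?_⟩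
    · have := hm.2
      change m.2 ∈ M.gr (i - 1 + 1)
      rwa [sub_add_cancel]
    · change m.1 - 0 = - M.d m.2 + (m.1 + M.d m.2)
      abel
    · change m.2 - 0 = (m.2 + M.d 0) + 0
      simp
  refine ⟨M, M, 𝟙 M, ⟨Triangle.isoMk _ _ (Iso.refl _) (Iso.refl _)
    ((isZero_zero _).iso hc) ?_ (hc.eq_of_tgt _ _) ((isZero_zero _).eq_of_src _ _)⟩⟩
  exact (Category.comp_id (𝟙 ((toK A).obj M))).trans
    (((toK A).map_id M).symm.trans (Category.id_comp ((toK A).map (𝟙 M))).symm)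

theorem distK_cone {X Y : HomotopyCat A} (f : X ⟶ Y) :
    ∃ (Z : HomotopyCat A) (g : Y ⟶ Z) (h : Z ⟶ X⟦(1 : ℤ)⟧), Triangle.mk f g h ∈ distK A := by
  obtain ⟨M⟩ := X
  obtain ⟨N⟩ := Y
  obtain ⟨f, rfl⟩ := (toK A).map_surjective (X := M) (Y := N) f
  exact ⟨_, _, _, M, N, f, ⟨Iso.refl _⟩⟩

/-- The homotopy equivalence between `M[1]` and the cone of `N ⟶ cone f`. -/
theorem distK_rotate_cone {M N : DGModule A} (f : M ⟶ N) :
    (toK A).mapTriangle.obj (coneTriangle f).rotate ∈ distK A := by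
  let c := cone (coneIn f)
  let u : M⟦(1 : ℤ)⟧ ⟶ c :=
    { lin := (LinearMap.prod (-f.lin) (LinearMap.inl Aᵐᵒᵖ M N) : M →ₗ[Aᵐᵒᵖ] N × (M × N))
      map_mem := fun hm => ⟨neg_mem (lin_mem f hm), hm, zero_mem _⟩
      comm := fun (m : M) => by
        refine Prod.ext ?_ (Prod.ext ?_ ?_)
        · change - f.lin (sgn 1 • M.d m) = - N.d (- f.lin m)
          simp [sgn_one, lin_d]
        · change sgn 1 • M.d m = 0 + - M.d m
          simp [sgn_one]
        · change (0 : N) = - f.lin m + (f.lin m + N.d 0)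
          simp }
  let v : c ⟶ M⟦(1 : ℤ)⟧ :=
    { lin := (LinearMap.fst Aᵐᵒᵖ M N ∘ₗ LinearMap.snd Aᵐᵒᵖ N (M × N) : N × (M × N) →ₗ[Aᵐᵒᵖ] M)
      map_mem := fun hm => hm.2.1
      comm := fun m => by
        change 0 + - M.d m.2.1 = sgn 1 • M.d m.2.1
        simp [sgn_one] }
  let h : c →ₗ[Aᵐᵒᵖ] c := (LinearMap.inl Aᵐᵒᵖ N (M × N) ∘ₗ LinearMap.snd Aᵐᵒᵖ M N ∘ₗ
    LinearMap.snd Aᵐᵒᵖ N (M × N) : N × (M × N) →ₗ[Aᵐᵒᵖ] N × (M × N))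
  have hh : ∀ i, ∀ m ∈ c.gr i, h m ∈ c.gr (i - 1) := fun i m hm => ⟨by
    have := hm.2.2
    change m.2.2 ∈ N.gr (i - 1 + 1)
    rwa [sub_add_cancel], zero_mem _⟩
  have hvu : homotopic A (𝟙 c) (v ≫ u) := by
    refine ⟨h, hh, fun m => Prod.ext ?_ (Prod.ext ?_ ?_)⟩
    · change m.1 - (- f.lin m.2.1) = - N.d m.2.2 + (m.1 + (f.lin m.2.1 + N.d m.2.2))
      abel
    · change m.2.1 - m.2.1 = (0 + - M.d 0) + 0
      simp
    · change m.2.2 - 0 = (m.2.2 + (f.lin 0 + N.d 0)) + 0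
      simp
  refine ⟨_, _, coneIn f, ⟨mapTriangleIsoK (Iso.refl _) (Iso.refl _)
    (isoK u v (homotopic_of_lin fun _ => rfl) (homotopic_symm hvu)) u rfl ?_ ?_
    (homotopic_of_lin fun _ => rfl)⟩⟩
  · exact (Category.comp_id _).trans (Category.id_comp _).symm
  · refine homotopic_symm ⟨h ∘ₗ (coneIn (coneIn f)).lin,
      fun i m hm => hh i _ (lin_mem _ hm), fun m => Prod.ext ?_ (Prod.ext ?_ ?_)⟩
    · change 0 - (- f.lin m.1) = - N.d m.2 + (f.lin m.1 + N.d m.2)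
      abel
    · change m.1 - m.1 = (0 + - M.d 0) + 0
      simp
    · change m.2 - 0 = (m.2 + (f.lin 0 + N.d 0)) + 0
      simp

theorem shiftFunctorAdd'_lin (M : DGModule A) (a b c : ℤ) (h : a + b = c) (m : M) :
    Hom.lin ((shiftFunctorAdd' (DGModule A) a b c h).hom.app M) m = m := by
  subst h
  rw [shiftFunctorAdd'_eq_shiftFunctorAdd]
  rfl

theorem shiftNegShift_lin (M : DGModule A) (m : M) :
    Hom.lin (shiftNegShift M (1 : ℤ)).inv m = m := by
  refine (congrArg (fun f => Hom.lin f m)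
    (show (shiftNegShift M (1 : ℤ)).inv = (shiftFunctorZero (DGModule A) ℤ).inv.app M ≫
      (shiftFunctorAdd' (DGModule A) (-1) 1 0 (by simp)).hom.app M from rfl)).trans ?_
  exact shiftFunctorAdd'_lin M (-1) 1 0 (by simp) m

theorem shiftShiftNeg_lin (M : DGModule A) (m : M) :
    Hom.lin (shiftShiftNeg M (1 : ℤ)).hom m = m := by
  have h : Hom.lin (shiftShiftNeg M (1 : ℤ)).inv m = m := by
    refine (congrArg (fun f => Hom.lin f m)
      (show (shiftShiftNeg M (1 : ℤ)).inv = (shiftFunctorZero (DGModule A) ℤ).inv.app M ≫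
        (shiftFunctorAdd' (DGModule A) 1 (-1) 0 (by simp)).hom.app M from rfl)).trans ?_
    exact shiftFunctorAdd'_lin M 1 (-1) 0 (by simp) m
  have h' := congrArg (fun f => Hom.lin f m) (shiftShiftNeg M (1 : ℤ)).inv_hom_id
  exact (congrArg (Hom.lin (shiftShiftNeg M (1 : ℤ)).hom) h).symm.trans h'

theorem invRotate_mor₁_lin {M N : DGModule A} (f : M ⟶ N) (m : M × N) :
    Hom.lin (coneTriangle f).invRotate.mor₁ m = - m.1 :=
  congrArg (fun x : M => - x) (shiftShiftNeg_lin M m.1)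

theorem distK_invRotate_cone {M N : DGModule A} (f : M ⟶ N) :
    (toK A).mapTriangle.obj (coneTriangle f).invRotate ∈ distK A := by
  let q : (cone f)⟦(-1 : ℤ)⟧ ⟶ M := (coneTriangle f).invRotate.mor₁
  have hq : ∀ m : M × N, q.lin m = - m.1 := invRotate_mor₁_lin f
  let c := cone q
  let v : c ⟶ N :=
    { lin := (LinearMap.snd Aᵐᵒᵖ M N ∘ₗ LinearMap.fst Aᵐᵒᵖ (M × N) M +
        f.lin ∘ₗ LinearMap.snd Aᵐᵒᵖ (M × N) M : (M × N) × M →ₗ[Aᵐᵒᵖ] N)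
      map_mem := fun {i m} hm => add_mem (by
        have := hm.1.2
        change m.1.2 ∈ N.gr (i + 1 + -1) at this
        rwa [add_neg_cancel_right] at this) (lin_mem f hm.2)
      comm := fun (m : (M × N) × M) => by
        change (- (sgn (-1) • ((- M.d m.1.1, f.lin m.1.1 + N.d m.1.2) : M × N))).2 +
          f.lin (q.lin m.1 + M.d m.2) = N.d (m.1.2 + f.lin m.2)
        rw [hq]
        simp [sgn, lin_d]
        abel }
  let u : N ⟶ c :=
    { lin := (LinearMap.inl Aᵐᵒᵖ (M × N) M ∘ₗ LinearMap.inr Aᵐᵒᵖ M N : N →ₗ[Aᵐᵒᵖ] (M × N) × M)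
      map_mem := fun {i m} hm => ⟨⟨zero_mem _, by
        change m ∈ N.gr (i + 1 + -1)
        rwa [add_neg_cancel_right]⟩, zero_mem _⟩
      comm := fun (m : N) => by
        refine Prod.ext ?_ ?_
        · change ((0, N.d m) : M × N) =
            - (sgn (-1) • ((- M.d 0, f.lin 0 + N.d m) : M × N))
          simp [sgn]
        · change (0 : M) = q.lin (0, m) + M.d 0
          rw [hq]
          simp }
  let h : c →ₗ[Aᵐᵒᵖ] c := (- (LinearMap.inl Aᵐᵒᵖ (M × N) M ∘ₗ LinearMap.inl Aᵐᵒᵖ M N ∘ₗ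
    LinearMap.snd Aᵐᵒᵖ (M × N) M) : (M × N) × M →ₗ[Aᵐᵒᵖ] (M × N) × M)
  have hh : ∀ i, ∀ m ∈ c.gr i, h m ∈ c.gr (i - 1) := fun i m hm => neg_mem ⟨⟨by
    have := hm.2
    change m.2 ∈ M.gr (i - 1 + 1 + -1 + 1)
    simpa using this, zero_mem _⟩, zero_mem _⟩
  have hvu : homotopic A (𝟙 c) (v ≫ u) := by
    refine ⟨h, hh, fun (m : (M × N) × M) => ?_⟩
    change m - (((0, m.1.2 + f.lin m.2), 0) : (M × N) × M) =
      (- (sgn (-1) • ((- M.d (- m.2), f.lin (- m.2) + N.d (- 0)) : M × N)),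
        q.lin ((- m.2, - 0) : M × N) + M.d (- 0)) +
      - (((q.lin m.1 + M.d m.2, 0), 0) : (M × N) × M)
    rw [hq, hq]
    ext <;> simp [sgn]
  refine ⟨_, _, q, ⟨mapTriangleIsoK (Iso.refl _) (Iso.refl _)
    (isoK u v (homotopic_of_lin fun (m : N) => ?_) (homotopic_symm hvu)) u rfl ?_ ?_ ?_⟩⟩
  · change m + f.lin 0 = m
    simp
  · exact (Category.comp_id _).trans (Category.id_comp _).symm
  · refine homotopic_symm ⟨h ∘ₗ (coneIn q).lin, fun i m hm => hh i _ (lin_mem _ hm),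
      fun (m : M) => ?_⟩
    change ((((0 : M), (0 : N)), m) : (M × N) × M) - (((0 : M), f.lin m), (0 : M)) =
      (- (sgn (-1) • ((- M.d (- m), f.lin (- m) + N.d (- 0)) : M × N)),
        q.lin ((- m, - 0) : M × N) + M.d (- 0)) + - (((M.d m, 0), 0) : (M × N) × M)
    rw [hq]
    ext <;> simp [sgn]
  · exact homotopic_of_lin fun m => shiftNegShift_lin (cone f) ((0, m) : M × N)

theorem distK_of_mapTriangle_rotate (T : Triangle (HomotopyCat A)) (hT : T ∈ distK A) :
    T.rotate ∈ distK A := by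
  obtain ⟨M, N, f, ⟨e⟩⟩ := hT
  exact distK_of_iso (distK_rotate_cone f) ((rotate _).mapIso e ≪≫
    ((toK A).mapTriangleRotateIso.app (coneTriangle f)))

theorem distK_of_mapTriangle_invRotate (T : Triangle (HomotopyCat A)) (hT : T ∈ distK A) :
    T.invRotate ∈ distK A := by
  obtain ⟨M, N, f, ⟨e⟩⟩ := hT
  exact distK_of_iso (distK_invRotate_cone f) ((invRotate _).mapIso e ≪≫
    ((toK A).mapTriangleInvRotateIso.app (coneTriangle f)))

theorem toK_map_shift {M N P : DGModule A} (g : P ⟶ M⟦(1 : ℤ)⟧) (a : M ⟶ N) :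
    ((toK A).map g ≫ ((toK A).commShiftIso (1 : ℤ)).hom.app M) ≫ ((toK A).map a)⟦(1 : ℤ)⟧' =
      (toK A).map (g ≫ a⟦(1 : ℤ)⟧') ≫ ((toK A).commShiftIso (1 : ℤ)).hom.app N := by
  have := ((toK A).commShiftIso (1 : ℤ)).hom.naturality a
  rw [Category.assoc, ← Functor.comp_map, ← this, Functor.comp_map, ← Category.assoc,
    ← Functor.map_comp]

theorem distK_complete_cone {M N M' N' : DGModule A} (f : M ⟶ N) (f' : M' ⟶ N')
    (a : (toK A).obj M ⟶ (toK A).obj M') (b : (toK A).obj N ⟶ (toK A).obj N')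
    (h : (toK A).map f ≫ b = a ≫ (toK A).map f') :
    ∃ c : (toK A).obj (cone f) ⟶ (toK A).obj (cone f'),
      (toK A).map (coneIn f) ≫ c = b ≫ (toK A).map (coneIn f') ∧
      ((toK A).map (coneOut f) ≫ ((toK A).commShiftIso (1 : ℤ)).hom.app M) ≫ a⟦(1 : ℤ)⟧' =
        c ≫ (toK A).map (coneOut f') ≫ ((toK A).commShiftIso (1 : ℤ)).hom.app M' := by
  obtain ⟨a, rfl⟩ := (toK A).map_surjective a
  obtain ⟨b, rfl⟩ := (toK A).map_surjective b
  rw [← Functor.map_comp, ← Functor.map_comp, CategoryTheory.Quotient.functor_map_eq_iff] at h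
  obtain ⟨h, h₁, h₂⟩ := h
  refine ⟨(toK A).map (coneMap f f' a b h h₁ h₂), ?_, ?_⟩
  · rw [← Functor.map_comp, ← Functor.map_comp]
    refine toK_eq (homotopic_of_lin fun m => Prod.ext ?_ ?_)
    · change a.lin 0 = 0
      simp
    · change h 0 + b.lin m = b.lin m
      simp
  · rw [toK_map_shift, ← Category.assoc, ← Functor.map_comp]
    rfl

theorem complete_of_iso {C : Type*} [Category C] [HasShift C ℤ] {T T' S S' : Triangle C}
    (e : T ≅ S) (e' : T' ≅ S')
    (H : ∀ (a : S.obj₁ ⟶ S'.obj₁) (b : S.obj₂ ⟶ S'.obj₂), S.mor₁ ≫ b = a ≫ S'.mor₁ →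
      ∃ c : S.obj₃ ⟶ S'.obj₃, S.mor₂ ≫ c = b ≫ S'.mor₂ ∧
        S.mor₃ ≫ a⟦(1 : ℤ)⟧' = c ≫ S'.mor₃)
    (a : T.obj₁ ⟶ T'.obj₁) (b : T.obj₂ ⟶ T'.obj₂) (comm : T.mor₁ ≫ b = a ≫ T'.mor₁) :
    ∃ c : T.obj₃ ⟶ T'.obj₃, T.mor₂ ≫ c = b ≫ T'.mor₂ ∧
        T.mor₃ ≫ a⟦(1 : ℤ)⟧' = c ≫ T'.mor₃ := by
  obtain ⟨c, hc, hc'⟩ := H (e.inv.hom₁ ≫ a ≫ e'.hom.hom₁) (e.inv.hom₂ ≫ b ≫ e'.hom.hom₂) (by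
    rw [e.inv.comm₁_assoc, reassoc_of% comm, e'.hom.comm₁, Category.assoc, Category.assoc])
  refine ⟨e.hom.hom₃ ≫ c ≫ e'.inv.hom₃, ?_, ?_⟩
  · rw [e.hom.comm₂_assoc, reassoc_of% hc, e'.inv.comm₂]
    simp
  · have : a⟦(1 : ℤ)⟧' = e.hom.hom₁⟦(1 : ℤ)⟧' ≫ (e.inv.hom₁ ≫ a ≫ e'.hom.hom₁)⟦(1 : ℤ)⟧' ≫
        e'.inv.hom₁⟦(1 : ℤ)⟧' := by
      rw [← Functor.map_comp, ← Functor.map_comp]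
      simp
    rw [this, e.hom.comm₃_assoc, reassoc_of% hc', Category.assoc, Category.assoc, e'.inv.comm₃]

instance : Pretriangulated (HomotopyCat A) where
  distinguishedTriangles := distK A
  isomorphic_distinguished _ h _ e := distK_of_iso h e
  contractible_distinguished := distK_contractible
  distinguished_cocone_triangle := distK_cone
  rotate_distinguished_triangle T :=
    ⟨distK_of_mapTriangle_rotate T, fun h =>
      distK_of_iso (distK_of_mapTriangle_invRotate _ h) ((triangleRotation _).unitIso.app T)⟩
  complete_distinguished_triangle_morphism := by
    rintro T T' ⟨M, N, f, ⟨e⟩⟩ ⟨M', N', f', ⟨e'⟩⟩ a b comm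
    exact complete_of_iso e e' (distK_complete_cone f f') a b comm

theorem distK_iff (T : Triangle (HomotopyCat A)) :
    T ∈ distTriang (HomotopyCat A) ↔ ∃ (M N : DGModule A) (f : M ⟶ N),
      Nonempty (T ≅ (toK A).mapTriangle.obj (coneTriangle f)) := Iff.rfl

theorem coneTriangle_distinguished {M N : DGModule A} (f : M ⟶ N) :
    (toK A).mapTriangle.obj (coneTriangle f) ∈ distTriang (HomotopyCat A) :=
  ⟨M, N, f, ⟨Iso.refl _⟩⟩

/-- The map `cone f ⟶ cone (f ≫ g)` induced by `g`. -/
def coneComp {M N P : DGModule A} (f : M ⟶ N) (g : N ⟶ P) : cone f ⟶ cone (f ≫ g) :=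
  coneMap f (f ≫ g) (𝟙 M) g 0 (fun _ _ _ => zero_mem _) (fun m => by
    change g.lin (f.lin m) - g.lin (f.lin m) = _; simp)

/-- The map `cone (f ≫ g) ⟶ cone g` induced by `f`. -/
def coneComp' {M N P : DGModule A} (f : M ⟶ N) (g : N ⟶ P) : cone (f ≫ g) ⟶ cone g :=
  coneMap (f ≫ g) g f (𝟙 P) 0 (fun _ _ _ => zero_mem _) (fun m => by
    change g.lin (f.lin m) - g.lin (f.lin m) = _; simp)

theorem distK_octahedron {M N P : DGModule A} (f : M ⟶ N) (g : N ⟶ P) :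
    (toK A).mapTriangle.obj (Triangle.mk
      (coneComp f g) (coneComp' f g)
      (coneOut g ≫ (coneIn f)⟦(1 : ℤ)⟧')) ∈ distK A := by
  let α := coneComp f g
  let c := cone α
  let u : cone g ⟶ c :=
    { lin := (LinearMap.prodMap (LinearMap.inr Aᵐᵒᵖ M N) (LinearMap.inr Aᵐᵒᵖ M P) :
        N × P →ₗ[Aᵐᵒᵖ] (M × N) × (M × P))
      map_mem := fun hm => ⟨⟨zero_mem _, hm.1⟩, zero_mem _, hm.2⟩
      comm := fun (m : N × P) => by
        refine Prod.ext (Prod.ext ?_ ?_) (Prod.ext ?_ ?_)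
        · change (0 : M) = - - M.d 0
          simp
        · change - N.d m.1 = - (f.lin 0 + N.d m.1)
          simp
        · change (0 : M) = 0 + - M.d 0
          simp
        · change g.lin m.1 + P.d m.2 = (0 + g.lin m.1) + (g.lin (f.lin 0) + P.d m.2)
          simp }
  let v : c ⟶ cone g :=
    { lin := (LinearMap.prodMap (LinearMap.snd Aᵐᵒᵖ M N) (LinearMap.snd Aᵐᵒᵖ M P) +
        LinearMap.inl Aᵐᵒᵖ N P ∘ₗ f.lin ∘ₗ LinearMap.fst Aᵐᵒᵖ M P ∘ₗ
          LinearMap.snd Aᵐᵒᵖ (M × N) (M × P) : (M × N) × (M × P) →ₗ[Aᵐᵒᵖ] N × P)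
      map_mem := fun {i m} hm => ⟨add_mem hm.1.2 (lin_mem f hm.2.1),
        add_mem (S := Submodule k P) hm.2.2 (zero_mem _)⟩
      comm := fun (m : (M × N) × (M × P)) => by
        refine Prod.ext ?_ ?_
        · change - (f.lin m.1.1 + N.d m.1.2) + f.lin (m.1.1 + - M.d m.2.1) =
            - N.d (m.1.2 + f.lin m.2.1)
          simp [lin_d]
          abel
        · change (0 + g.lin m.1.2) + (g.lin (f.lin m.2.1) + P.d m.2.2) + 0 =
            g.lin (m.1.2 + f.lin m.2.1) + P.d (m.2.2 + 0)
          simp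
          abel }
  let h : c →ₗ[Aᵐᵒᵖ] c := (LinearMap.inl Aᵐᵒᵖ (M × N) (M × P) ∘ₗ LinearMap.inl Aᵐᵒᵖ M N ∘ₗ
    LinearMap.fst Aᵐᵒᵖ M P ∘ₗ LinearMap.snd Aᵐᵒᵖ (M × N) (M × P) :
      (M × N) × (M × P) →ₗ[Aᵐᵒᵖ] (M × N) × (M × P))
  have hh : ∀ i, ∀ m ∈ c.gr i, h m ∈ c.gr (i - 1) := fun i m hm => ⟨⟨by
    have := hm.2.1
    change m.2.1 ∈ M.gr (i - 1 + 1 + 1)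
    rwa [sub_add_cancel], zero_mem _⟩, zero_mem _⟩
  have hvu : homotopic A (𝟙 c) (v ≫ u) := by
    refine ⟨h, hh, fun (m : (M × N) × (M × P)) => Prod.ext (Prod.ext ?_ ?_) (Prod.ext ?_ ?_)⟩
    · change m.1.1 - 0 = - - M.d m.2.1 + (m.1.1 + - M.d m.2.1)
      abel
    · change m.1.2 - (m.1.2 + f.lin m.2.1) = - (f.lin m.2.1 + N.d 0) + 0
      simp
    · change m.2.1 - 0 = (m.2.1 + - M.d 0) + 0
      simp
    · change m.2.2 - (m.2.2 + 0) = ((0 + g.lin 0) + (g.lin (f.lin 0) + P.d 0)) + 0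
      simp
  refine ⟨_, _, α, ⟨mapTriangleIsoK (Iso.refl _) (Iso.refl _)
    (isoK u v (homotopic_of_lin fun (m : N × P) => Prod.ext ?_ ?_) (homotopic_symm hvu))
      u rfl ?_ ?_ (homotopic_of_lin fun _ => rfl)⟩⟩
  · change m.1 + f.lin 0 = m.1
    simp
  · change m.2 + 0 = m.2
    simp
  · exact (Category.comp_id _).trans (Category.id_comp _).symm
  · refine homotopic_symm ⟨h ∘ₗ (coneIn α).lin, fun i m hm => hh i _ (lin_mem _ hm),
      fun (m : M × P) => Prod.ext (Prod.ext ?_ ?_) (Prod.ext ?_ ?_)⟩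
    · change (0 : M) - 0 = - - M.d m.1 + - M.d m.1
      simp
    · change (0 : N) - f.lin m.1 = - (f.lin m.1 + N.d 0) + 0
      simp
    · change m.1 - 0 = (m.1 + - M.d 0) + 0
      simp
    · change m.2 - (0 + m.2) = ((0 + g.lin 0) + (g.lin (f.lin 0) + P.d 0)) + 0
      simp

theorem octahedron₁ {M N P : DGModule A} (f : M ⟶ N) (g : N ⟶ P) :
    (toK A).map (coneIn f) ≫ (toK A).map (coneComp f g) =
      (toK A).map g ≫ (toK A).map (coneIn (f ≫ g)) := by
  rw [← Functor.map_comp, ← Functor.map_comp]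
  refine toK_eq (homotopic_of_lin fun m => Prod.ext rfl ?_)
  change 0 + g.lin m = g.lin m
  simp

theorem octahedron₂ {M N P : DGModule A} (f : M ⟶ N) (g : N ⟶ P) :
    (toK A).map (coneComp f g) ≫ (toK A).map (coneOut (f ≫ g)) = (toK A).map (coneOut f) := by
  rw [← Functor.map_comp]
  rfl

theorem octahedron₃ {M N P : DGModule A} (f : M ⟶ N) (g : N ⟶ P) :
    (toK A).map (coneIn (f ≫ g)) ≫ (toK A).map (coneComp' f g) = (toK A).map (coneIn g) := by
  rw [← Functor.map_comp]
  refine toK_eq (homotopic_of_lin fun m => Prod.ext ?_ ?_)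
  · change f.lin 0 = 0
    simp
  · change 0 + m = m
    simp

theorem octahedron₄ {M N P : DGModule A} (f : M ⟶ N) (g : N ⟶ P) :
    (toK A).map (coneOut (f ≫ g) ≫ f⟦(1 : ℤ)⟧') =
      (toK A).map (coneComp' f g) ≫ (toK A).map (coneOut g) := by
  rw [← Functor.map_comp]
  rfl

theorem octahedron₅ {M N P : DGModule A} (f : M ⟶ N) (g : N ⟶ P) :
    Triangle.mk ((toK A).map (coneComp f g)) ((toK A).map (coneComp' f g))
      (((toK A).map (coneOut g) ≫ ((toK A).commShiftIso (1 : ℤ)).hom.app N) ≫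
        ((toK A).map (coneIn f))⟦(1 : ℤ)⟧') ∈ distK A := by
  rw [toK_map_shift]
  exact distK_octahedron f g

instance : IsTriangulated (HomotopyCat A) := IsTriangulated.mk' (by
  rintro ⟨M⟩ ⟨N⟩ ⟨P⟩ f g
  obtain ⟨f, rfl⟩ := (toK A).map_surjective (X := M) (Y := N) f
  obtain ⟨g, rfl⟩ := (toK A).map_surjective (X := N) (Y := P) g
  refine ⟨_, _, _, _, _, _, _, _, Iso.refl _, Iso.refl _, Iso.refl _,
    (Category.comp_id _).trans (Category.id_comp _).symm,
    (Category.comp_id _).trans (Category.id_comp _).symm,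
    _, _, coneTriangle_distinguished f, _, _, coneTriangle_distinguished g,
    _, _, coneTriangle_distinguished (f ≫ g), ⟨?_⟩⟩
  exact Triangulated.Octahedron.mk ((toK A).map (coneComp f g)) ((toK A).map (coneComp' f g))
    (octahedron₁ f g)
    ((Category.assoc _ _ _).symm.trans (congrArg (· ≫ _) (octahedron₂ f g)))
    (octahedron₃ f g)
    ((toK_map_shift _ f).trans ((congrArg (· ≫ _) (octahedron₄ f g)).trans
      (Category.assoc _ _ _)))
    (octahedron₅ f g))

/-- A DG module is acyclic if every cycle is a boundary. The differential is homogeneous of degree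
one, so this is the vanishing of the cohomology in every degree. -/
def DGModule.Acyclic (M : DGModule A) : Prop := ∀ m, M.d m = 0 → ∃ m', M.d m' = m

theorem DGModule.Acyclic.of_homotopic {M N : DGModule A} (hM : M.Acyclic) {f : N ⟶ M} {g : M ⟶ N}
    (h : homotopic A (f ≫ g) (𝟙 N)) : N.Acyclic := fun n hn => by
  obtain ⟨h, -, h₂⟩ := homotopic_symm h
  obtain ⟨m, hm⟩ := hM (f.lin n) (by rw [← lin_d, hn, map_zero])
  refine ⟨g.lin m + h n, ?_⟩
  have := h₂ n
  rw [hn, map_zero, add_zero, linId, linComp, ← hm, lin_d, sub_eq_iff_eq_add] at this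
  rw [map_add, add_comm]
  exact this.symm

theorem DGModule.Acyclic.shift {M : DGModule A} (hM : M.Acyclic) (n : ℤ) : (M⟦n⟧).Acyclic :=
  fun (m : M) hm => by
    have hm' : sgn n • M.d m = 0 := hm
    obtain ⟨m', rfl⟩ := hM m (by rw [← sgn_smul_smul n (M.d m), hm', smul_zero])
    refine ⟨(sgn n • m' : M), ?_⟩
    change sgn n • M.d (sgn n • m') = _
    rw [map_zsmul, sgn_smul_smul]

theorem DGModule.Acyclic.cone {M N : DGModule A} (f : M ⟶ N) (hM : M.Acyclic) (hN : N.Acyclic) :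
    (cone f).Acyclic := fun (m : M × N) hm => by
  have h₁ : - M.d m.1 = 0 := congrArg Prod.fst hm
  have h₂ : f.lin m.1 + N.d m.2 = 0 := congrArg Prod.snd hm
  obtain ⟨x, hx⟩ := hM m.1 (neg_eq_zero.1 h₁)
  obtain ⟨y, hy⟩ := hN (f.lin x + m.2) (by rw [map_add, ← lin_d, hx, h₂])
  refine ⟨((-x, y) : M × N), Prod.ext ?_ ?_⟩
  · change - M.d (-x) = m.1
    rw [map_neg, neg_neg, hx]
  · change f.lin (-x) + N.d y = m.2
    rw [hy, map_neg, neg_add_cancel_left]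

variable (A) in
/-- The acyclic objects of the homotopy category. -/
def acyclicK : ObjectProperty (HomotopyCat A) := fun X => X.as.Acyclic

instance : (acyclicK A).IsClosedUnderIsomorphisms where
  of_iso := by
    rintro ⟨M⟩ ⟨N⟩ e hM
    obtain ⟨f, hf⟩ := (toK A).map_surjective (X := N) (Y := M) e.inv
    obtain ⟨g, hg⟩ := (toK A).map_surjective (X := M) (Y := N) e.hom
    refine DGModule.Acyclic.of_homotopic hM (f := f) (g := g)
      ((CategoryTheory.Quotient.functor_map_eq_iff (homotopic A) _ _).1 ?_)
    exact ((toK A).map_comp f g).trans ((congrArg₂ (· ≫ ·) hf hg).trans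
      (e.inv_hom_id.trans ((toK A).map_id N).symm))

instance : (acyclicK A).IsStableUnderShift ℤ where
  isStableUnderShiftBy n := ⟨fun ⟨M⟩ hM => (acyclicK A).prop_of_iso
    (((toK A).commShiftIso n).app M) (DGModule.Acyclic.shift (M := M) hM n)⟩

instance : (acyclicK A).IsTriangulated where
  exists_zero := ⟨(toK A).obj zeroModule, (toK A).map_isZero isZero_zeroModule, fun _ _ => ⟨0, rfl⟩⟩
  toIsTriangulatedClosed₂ := by
    have : (acyclicK A).IsTriangulatedClosed₃ := .mk' (by
      rintro T ⟨M, N, f, ⟨e⟩⟩ h₁ h₂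
      exact (acyclicK A).prop_of_iso (Triangle.π₃.mapIso e).symm
        (DGModule.Acyclic.cone f ((acyclicK A).prop_of_iso (Triangle.π₁.mapIso e) h₁)
          ((acyclicK A).prop_of_iso (Triangle.π₂.mapIso e) h₂)))
    exact .of_isTriangulatedClosed₃

/-- The derived category of `A`: the Verdier quotient of the homotopy category of right DG modules
by the triangulated subcategory of acyclic modules. -/
abbrev DerivedCat (A : DGAlgebra k) := (acyclicK A).trW.Localization

variable (A) in
/-- The quotient functor from the homotopy category to the derived category. -/
abbrev qD : HomotopyCat A ⥤ DerivedCat A := (acyclicK A).trW.Q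

variable (A) in
/-- The object of the derived category given by a DG module. -/
abbrev toD : DGModule A ⥤ DerivedCat A := toK A ⋙ qD A


namespace DGModule

theorem signOp_smul (M : DGModule A) (m : M) {j : ℤ} {a : A} (ha : a ∈ A.gr j) :
    signOp M.isInternal (m <• a) = sgn j • (signOp M.isInternal m <• a) := by
  refine graded_induction M.isInternal (fun i v hv => ?_) (fun v w hv hw => ?_) m
  · rw [signOp_of_mem _ (M.smul_mem hv ha), signOp_of_mem _ hv, sgn_add, mul_comm, mul_smul]
    exact congrArg (sgn j • ·) (smul_comm (MulOpposite.op a) (sgn i) v).symm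
  · rw [smul_add, map_add, hv, hw, map_add, smul_add, smul_add]

theorem signOp_d (M : DGModule A) (m : M) :
    signOp M.isInternal (M.d m) = - M.d (signOp M.isInternal m) := by
  refine graded_induction M.isInternal (fun i v hv => ?_) (fun v w hv hw => ?_) m
  · rw [signOp_of_mem _ (M.d_mem hv), signOp_of_mem _ hv, sgn_add, sgn_one, map_zsmul,
      mul_neg_one, neg_smul]
  · rw [map_add, map_add, hv, hw, map_add, map_add, neg_add]

theorem leibniz_signOp (M : DGModule A) (m : M) (a : A) :
    M.d (m <• a) = M.d m <• a + signOp M.isInternal m <• A.d a := by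
  refine graded_induction M.isInternal (fun i v hv => ?_) (fun v w hv hw => ?_) m
  · rw [M.leibniz hv, signOp_of_mem _ hv]
    exact congrArg (_ + ·) (smul_comm (MulOpposite.op (A.d a)) (sgn i) v).symm
  · rw [smul_add, map_add, hv, hw, map_add, map_add, smul_add, smul_add]
    abel

/-- The operator `f ↦ (-1)^n f` for `f` of degree `n`. -/
def homSign (P N : DGModule A) : (P →ₗ[Aᵐᵒᵖ] N) →ₗ[k] (P →ₗ[Aᵐᵒᵖ] N) where
  toFun f :=
    { toFun := fun m => signOp N.isInternal (f (signOp P.isInternal m))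
      map_add' := fun v w => by simp
      map_smul' := fun a v => by
        induction a using MulOpposite.rec' with | _ a => ?_
        refine graded_induction A.isInternal (p := fun a => signOp N.isInternal
          (f (signOp P.isInternal (v <• a))) = signOp N.isInternal (f (signOp P.isInternal v)) <• a)
          (fun i a ha => ?_) (fun a b ha hb => ?_) a
        · rw [signOp_smul P v ha, map_zsmul f, map_zsmul (signOp N.isInternal), map_smul,
            signOp_smul N _ ha, sgn_smul_smul]
        · rw [MulOpposite.op_add, add_smul, map_add, map_add, map_add, ha, hb, add_smul] }
  map_add' f g := by ext; simp
  map_smul' c f := by ext; simp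

/-- The submodule of `A`-linear maps of degree `n` between DG modules. -/
def homDeg (P N : DGModule A) (n : ℤ) : Submodule k (P →ₗ[Aᵐᵒᵖ] N) where
  carrier := {f | ∀ i, ∀ m ∈ P.gr i, f m ∈ N.gr (i + n)}
  zero_mem' _ _ _ := zero_mem _
  add_mem' hf hg i m hm := add_mem (hf i m hm) (hg i m hm)
  smul_mem' c _ hf i m hm := Submodule.smul_mem _ c (hf i m hm)

theorem homSign_of_mem {P N : DGModule A} {n : ℤ} {f : P →ₗ[Aᵐᵒᵖ] N} (hf : f ∈ homDeg P N n) :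
    homSign P N f = sgn n • f := by
  refine LinearMap.ext fun m => ?_
  refine graded_induction P.isInternal (fun i v hv => ?_) (fun v w hv hw => ?_) m
  · change signOp N.isInternal (f (signOp P.isInternal v)) = sgn n • f v
    rw [signOp_of_mem _ hv, map_zsmul f, map_zsmul (signOp N.isInternal), signOp_of_mem _ (hf i v hv), smul_smul, sgn_add,
      ← mul_assoc, sgn_mul_self, one_mul]
  · rw [map_add, hv, hw, map_add]

/-- The differential of the `Hom` complex: `f ↦ d f - (-1)^n f d` for `f` of degree `n`. -/
def homD (P N : DGModule A) : (P →ₗ[Aᵐᵒᵖ] N) →ₗ[k] (P →ₗ[Aᵐᵒᵖ] N) where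
  toFun f :=
    { toFun := fun m => N.d (f m) - homSign P N f (P.d m)
      map_add' := fun v w => by simp; abel
      map_smul' := fun a v => by
        induction a using MulOpposite.rec' with | _ a => ?_
        have : homSign P N f (signOp P.isInternal v) = signOp N.isInternal (f v) := by
          change signOp N.isInternal (f (signOp P.isInternal (signOp P.isInternal v))) = _
          rw [signOp_signOp]
        rw [map_smul, leibniz_signOp, leibniz_signOp, map_add, map_smul, map_smul, this,
          RingHom.id_apply, smul_sub]
        abel }
  map_add' f g := by ext; simp; abel
  map_smul' c f := by ext; simp [smul_sub]

theorem homD_apply {P N : DGModule A} (f : P →ₗ[Aᵐᵒᵖ] N) (m : P) :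
    homD P N f m = N.d (f m) - homSign P N f (P.d m) := rfl

theorem homD_of_mem {P N : DGModule A} {n : ℤ} {f : P →ₗ[Aᵐᵒᵖ] N} (hf : f ∈ homDeg P N n)
    (m : P) : homD P N f m = N.d (f m) - sgn n • f (P.d m) := by
  rw [homD_apply, homSign_of_mem hf]; rfl

theorem homD_mem {P N : DGModule A} {n : ℤ} {f : P →ₗ[Aᵐᵒᵖ] N} (hf : f ∈ homDeg P N n) :
    homD P N f ∈ homDeg P N (n + 1) := fun i m hm => by
  rw [homD_of_mem hf]
  refine sub_mem ?_ (zsmul_mem ?_ _)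
  · have := N.d_mem (hf i m hm)
    rwa [add_assoc] at this
  · have := hf _ _ (P.d_mem hm)
    rwa [add_assoc, add_comm 1 n] at this

theorem homComp_mem {P M N : DGModule A} {i j : ℤ} {f : M →ₗ[Aᵐᵒᵖ] N} {g : P →ₗ[Aᵐᵒᵖ] M}
    (hf : f ∈ homDeg M N i) (hg : g ∈ homDeg P M j) : f ∘ₗ g ∈ homDeg P N (i + j) :=
  fun l m hm => by
    have := hf _ _ (hg l m hm)
    rwa [add_assoc, add_comm j i] at this

theorem homD_comp {P M N : DGModule A} {i : ℤ} {f : M →ₗ[Aᵐᵒᵖ] N} (hf : f ∈ homDeg M N i)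
    (g : P →ₗ[Aᵐᵒᵖ] M) :
    homD P N (f ∘ₗ g) = homD M N f ∘ₗ g + sgn i • (f ∘ₗ homD P M g) := by
  refine LinearMap.ext fun m => ?_
  have h : homSign P N (f ∘ₗ g) (P.d m) = sgn i • f (homSign P M g (P.d m)) := by
    have := LinearMap.congr_fun (homSign_of_mem hf) (signOp M.isInternal
      (g (signOp P.isInternal (P.d m))))
    change signOp N.isInternal (f (signOp M.isInternal (signOp M.isInternal _))) = _ at this
    rw [signOp_signOp] at this
    exact this
  rw [homD_apply, h]
  change _ = homD M N f (g m) + sgn i • f (homD P M g m)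
  rw [homD_of_mem hf, homD_apply, map_sub, smul_sub]
  simp

theorem homD_homD {P N : DGModule A} (f : P →ₗ[Aᵐᵒᵖ] N) : homD P N (homD P N f) = 0 := by
  refine LinearMap.ext fun m => ?_
  rw [homD_apply, homD_apply, map_sub, N.d_d]
  change 0 - N.d (signOp N.isInternal (f (signOp P.isInternal (P.d m)))) -
    signOp N.isInternal (homD P N f (signOp P.isInternal (P.d m))) = 0
  have h : P.d (signOp P.isInternal (P.d m)) = 0 := by
    rw [← neg_eq_zero, ← signOp_d, P.d_d, map_zero]
  rw [homD_apply, h, map_zero, sub_zero, signOp_d N]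
  abel

end DGModule

namespace DGModule

/-- The underlying module of the `Hom` complex: the sums of homogeneous `A`-linear maps. -/
def homTot (P N : DGModule A) : Submodule k (P →ₗ[Aᵐᵒᵖ] N) := ⨆ n, homDeg P N n

theorem homDeg_le {P N : DGModule A} (n : ℤ) : homDeg P N n ≤ homTot P N := le_iSup _ n

@[elab_as_elim]
theorem homTot_induction {P N : DGModule A} {p : (P →ₗ[Aᵐᵒᵖ] N) → Prop}
    (hom : ∀ n, ∀ f ∈ homDeg P N n, p f) (add : ∀ f g, p f → p g → p (f + g))
    (f : P →ₗ[Aᵐᵒᵖ] N) (hf : f ∈ homTot P N) : p f :=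
  Submodule.iSup_induction _ (motive := p) hf hom (hom 0 0 (zero_mem _)) add

theorem homTot_comp {P M N : DGModule A} {f : M →ₗ[Aᵐᵒᵖ] N} {g : P →ₗ[Aᵐᵒᵖ] M}
    (hf : f ∈ homTot M N) (hg : g ∈ homTot P M) : f ∘ₗ g ∈ homTot P N := by
  refine homTot_induction (fun i f hf => ?_) (fun f f' hf hf' => ?_) f hf
  · refine homTot_induction (fun j g hg => ?_) (fun g g' hg hg' => ?_) g hg
    · exact homDeg_le _ (homComp_mem hf hg)
    · rw [LinearMap.comp_add]
      exact add_mem hg hg'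
  · rw [LinearMap.add_comp]
    exact add_mem hf hf'

theorem homTot_d {P N : DGModule A} {f : P →ₗ[Aᵐᵒᵖ] N} (hf : f ∈ homTot P N) :
    homD P N f ∈ homTot P N := by
  refine homTot_induction (fun i f hf => ?_) (fun f f' hf hf' => ?_) f hf
  · exact homDeg_le _ (homD_mem hf)
  · rw [map_add]
    exact add_mem hf hf'

/-- The component of degree `n` of the `Hom` complex. -/
def homGr (P N : DGModule A) (n : ℤ) : Submodule k (homTot P N) :=
  (homDeg P N n).comap (homTot P N).subtype

theorem homGr_isInternal (P N : DGModule A) : DirectSum.IsInternal (homGr P N) := by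
  refine isInternal_of_separating (T := Σ i, P.gr i) (W := N) ?_
    (fun t n => gradedProj N.isInternal (t.1 + n) ∘ₗ
      ({ toFun := fun f => f.1 t.2.1
         map_add' := fun _ _ => rfl
         map_smul' := fun _ _ => rfl } : homTot P N →ₗ[k] N)) ?_ ?_
  · rintro ⟨f, hf⟩
    have : ∃ h : f ∈ homTot P N, (⟨f, h⟩ : homTot P N) ∈ ⨆ n, homGr P N n := by
      refine homTot_induction (fun i f hf => ?_) (fun f f' hf hf' => ?_) f hf
      · exact ⟨homDeg_le _ hf, Submodule.mem_iSup_of_mem i hf⟩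
      · exact ⟨add_mem hf.1 hf'.1, add_mem hf.2 hf'.2⟩
    exact this.2
  · rintro n ⟨f, hf'⟩ hf h
    refine Subtype.ext (LinearMap.ext fun m => ?_)
    refine graded_induction P.isInternal (fun i v hv => ?_) (fun v w hv hw => ?_) m
    · exact (gradedProj_of_mem N.isInternal (hf i v hv)).symm.trans (h ⟨i, v, hv⟩)
    · rw [map_add, hv, hw, map_add]
  · rintro ⟨l, m, hm⟩ i j hij ⟨f, hf'⟩ hf
    exact gradedProj_of_mem_ne N.isInternal (by simpa using hij) (hf l m hm)

/-- The differential of the `Hom` complex. -/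
def homTotD (P N : DGModule A) : homTot P N →ₗ[k] homTot P N :=
  (homD P N).restrict fun _ => homTot_d

theorem id_mem_homDeg (P : DGModule A) : (1 : Module.End Aᵐᵒᵖ P) ∈ homDeg P P 0 :=
  fun i m hm => by rw [add_zero]; exact hm

/-- The algebra underlying the DG algebra of endomorphisms. -/
def endAlg (P : DGModule A) : Subalgebra k (Module.End Aᵐᵒᵖ P) where
  carrier := homTot P P
  mul_mem' := homTot_comp
  add_mem' := add_mem
  algebraMap_mem' c := by
    rw [Algebra.algebraMap_eq_smul_one]
    exact Submodule.smul_mem _ _ (homDeg_le 0 (id_mem_homDeg P))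

/-- The DG algebra of endomorphisms of a DG module. -/
def endDG (P : DGModule A) : DGAlgebra k where
  carrier := endAlg P
  gr := homGr P P
  isInternal := homGr_isInternal P P
  one_mem := id_mem_homDeg P
  mul_mem := homComp_mem
  d := homTotD P P
  d_mem := homD_mem
  d_d _ := Subtype.ext (homD_homD _)
  leibniz ha _ := Subtype.ext (homD_comp ha _)

instance (P N : DGModule A) : Module (endDG P)ᵐᵒᵖ (homTot P N) where
  smul e f := ⟨f.1 ∘ₗ e.unop.1, homTot_comp f.2 e.unop.2⟩
  one_smul _ := rfl
  mul_smul _ _ _ := rfl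
  smul_zero _ := rfl
  smul_add _ _ _ := rfl
  add_smul _ _ f := Subtype.ext (LinearMap.comp_add _ _ f.1)
  zero_smul f := Subtype.ext (LinearMap.comp_zero f.1)

/-- The complex `Hom(P, N)` as a right DG module over the DG algebra of endomorphisms of `P`, which
acts by composition. -/
def homDG (P N : DGModule A) : DGModule (endDG P) where
  carrier := homTot P N
  isScalarTower := ⟨fun c e f => Subtype.ext (LinearMap.ext fun m =>
    LinearMap.map_smul_of_tower f.1 c (e.unop.1 m))⟩
  gr := homGr P N
  isInternal := homGr_isInternal P N
  smul_mem := homComp_mem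
  d := homTotD P N
  d_mem := homD_mem
  d_d _ := Subtype.ext (homD_homD _)
  leibniz hm _ := Subtype.ext (homD_comp hm _)

/-- A DG module `P` is h-projective if `Hom(P, M)` is acyclic for every acyclic `M`. -/
def IsHProjective (P : DGModule A) : Prop := ∀ M : DGModule A, M.Acyclic → (homDG P M).Acyclic

/-- The map `Hom(P, M) ⟶ Hom(P, N)` given by composition with a homogeneous map. -/
def homPost (P : DGModule A) {M N : DGModule A} {n : ℤ} (f : M →ₗ[Aᵐᵒᵖ] N)
    (hf : f ∈ homDeg M N n) : homDG P M →ₗ[(endDG P)ᵐᵒᵖ] homDG P N where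
  toFun (g : homTot P M) := (⟨f ∘ₗ g.1, homTot_comp (homDeg_le _ hf) g.2⟩ : homTot P N)
  map_add' _ _ := Subtype.ext (LinearMap.comp_add _ _ f)
  map_smul' _ _ := rfl

theorem lin_mem_homDeg {M N : DGModule A} (f : M ⟶ N) : f.lin ∈ homDeg M N 0 := fun i m hm => by
  rw [add_zero]; exact lin_mem f hm

theorem homD_lin {M N : DGModule A} (f : M ⟶ N) : homD M N f.lin = 0 := LinearMap.ext fun m => by
  rw [homD_of_mem (lin_mem_homDeg f), lin_d, sgn_zero, one_smul, sub_self, LinearMap.zero_apply]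

/-- The morphism `Hom(P, M) ⟶ Hom(P, N)` given by composition with a morphism. -/
def homMap (P : DGModule A) {M N : DGModule A} (f : M ⟶ N) : homDG P M ⟶ homDG P N where
  lin := homPost P f.lin (lin_mem_homDeg f)
  map_mem {i} g hg := by
    have := homComp_mem (lin_mem_homDeg f) hg
    rwa [zero_add] at this
  comm g := Subtype.ext (by
    refine Eq.trans ?_ (homD_comp (lin_mem_homDeg f) _).symm
    rw [homD_lin, sgn_zero, one_smul, LinearMap.zero_comp, zero_add]
    rfl)

/-- The functor `Hom(P, -)` from DG modules to DG modules over the endomorphisms of `P`. -/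
def homFunctor (P : DGModule A) : DGModule A ⥤ DGModule (endDG P) where
  obj N := homDG P N
  map f := homMap P f
  map_id _ := rfl
  map_comp _ _ := rfl

end DGModule

namespace DGModule

theorem homotopic_homFunctor (P : DGModule A) {M N : DGModule A} {f g : M ⟶ N}
    (h : homotopic A f g) :
    homotopic (endDG P) ((homFunctor P).map f) ((homFunctor P).map g) := by
  obtain ⟨h, h₁, h₂⟩ := h
  have hm : h ∈ homDeg M N (-1) := h₁
  refine ⟨homPost P h hm, fun i m hi => ?_, fun m => Subtype.ext ?_⟩
  · have := homComp_mem hm hi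
    rwa [add_comm (-1) i] at this
  · have hD : homD M N h = f.lin - g.lin := LinearMap.ext fun x => by
      rw [homD_of_mem hm, LinearMap.sub_apply, h₂]
      simp [sgn]
    change f.lin ∘ₗ m.1 - g.lin ∘ₗ m.1 = homD P N (h ∘ₗ m.1) + h ∘ₗ homD P M m.1
    rw [homD_comp hm, hD, LinearMap.sub_comp]
    simp [sgn]

/-- The identity map `N ≃ N[n]`. -/
def shiftEquiv (N : DGModule A) (n : ℤ) : N ≃ₗ[Aᵐᵒᵖ] shiftObj N n := LinearEquiv.refl Aᵐᵒᵖ N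

theorem shiftEquiv_mem {N : DGModule A} {n i : ℤ} {m : N} :
    shiftEquiv N n m ∈ (shiftObj N n).gr i ↔ m ∈ N.gr (i + n) := Iff.rfl

theorem shiftEquiv_d (N : DGModule A) (n : ℤ) (m : N) :
    (shiftObj N n).d (shiftEquiv N n m) = shiftEquiv N n (sgn n • N.d m) := rfl

theorem shiftEquiv_symm_d (N : DGModule A) (n : ℤ) (m : shiftObj N n) :
    (shiftEquiv N n).symm ((shiftObj N n).d m) = sgn n • N.d ((shiftEquiv N n).symm m) := rfl

theorem shiftEquiv_mem_homDeg (N : DGModule A) (n : ℤ) :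
    (shiftEquiv N n).toLinearMap ∈ homDeg N (shiftObj N n) (-n) := fun i m hm => by
  refine shiftEquiv_mem.2 ?_
  rwa [neg_add_cancel_right]

theorem shiftEquiv_symm_mem_homDeg (N : DGModule A) (n : ℤ) :
    (shiftEquiv N n).symm.toLinearMap ∈ homDeg (shiftObj N n) N n := fun _ _ hm => hm

theorem homD_shiftEquiv_symm (N : DGModule A) (n : ℤ) :
    homD (shiftObj N n) N (shiftEquiv N n).symm.toLinearMap = 0 := LinearMap.ext fun m => by
  rw [homD_of_mem (shiftEquiv_symm_mem_homDeg N n), LinearEquiv.coe_coe, shiftEquiv_symm_d,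
    sgn_smul_smul, sub_self, LinearMap.zero_apply]

/-- The identity map `Hom(P, N[n]) ≃ Hom(P, N)[n]`. -/
def homShiftEquiv (P N : DGModule A) (n : ℤ) :
    homDG P (shiftObj N n) ≃ₗ[(endDG P)ᵐᵒᵖ] homDG P N :=
  LinearEquiv.ofLinearMap (homPost P _ (shiftEquiv_symm_mem_homDeg N n))
    (homPost P _ (shiftEquiv_mem_homDeg N n))
    (LinearMap.ext fun _ => Subtype.ext (LinearMap.ext fun _ =>
      (shiftEquiv N n).symm_apply_apply _))
    (LinearMap.ext fun _ => Subtype.ext (LinearMap.ext fun _ =>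
      (shiftEquiv N n).apply_symm_apply _))

theorem homShiftEquiv_mem (P N : DGModule A) (n i : ℤ) (f : homDG P (shiftObj N n)) :
    f ∈ (homDG P (shiftObj N n)).gr i ↔ homShiftEquiv P N n f ∈ (homDG P N).gr (i + n) := by
  refine forall_congr' fun j => forall_congr' fun m => forall_congr' fun _ => ?_
  rw [← add_assoc]
  exact Iff.rfl

theorem homShiftEquiv_d (P N : DGModule A) (n : ℤ) (f : homDG P (shiftObj N n)) :
    homShiftEquiv P N n ((homDG P (shiftObj N n)).d f) =
      sgn n • (homDG P N).d (homShiftEquiv P N n f) := by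
  refine Subtype.ext ?_
  have h := homD_comp (shiftEquiv_symm_mem_homDeg N n) (P := P) f.1
  rw [homD_shiftEquiv_symm, LinearMap.zero_comp, zero_add] at h
  have h' := congrArg (sgn n • ·) h
  exact (sgn_smul_smul n _).symm.trans h'.symm

/-- `Hom(P, N[n]) ≅ Hom(P, N)[n]`, by the identity map. -/
def homShiftIso (P N : DGModule A) (n : ℤ) :
    homDG P (shiftObj N n) ≅ shiftObj (homDG P N) n :=
  isoOfEq _ _ ((homShiftEquiv P N n).trans (shiftEquiv (homDG P N) n))
    (fun i f => (homShiftEquiv_mem P N n i f).trans shiftEquiv_mem.symm)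
    (fun f => congrArg (shiftEquiv (homDG P N) n) (homShiftEquiv_d P N n f))

end DGModule

namespace DGModule

theorem shiftAdd_hom_lin (M : DGModule A) (n m : ℤ) (x : shiftObj M (n + m)) :
    Hom.lin ((shiftFunctorAdd (DGModule A) n m).hom.app M) x =
      shiftEquiv (shiftObj M n) m (shiftEquiv M n ((shiftEquiv M (n + m)).symm x)) := rfl

theorem shiftAdd_inv_lin (M : DGModule A) (n m : ℤ) (x : shiftObj (shiftObj M n) m) :
    Hom.lin ((shiftFunctorAdd (DGModule A) n m).inv.app M) x =
      shiftEquiv M (n + m) ((shiftEquiv M n).symm ((shiftEquiv (shiftObj M n) m).symm x)) := rfl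

theorem homShiftIso_lin (P N : DGModule A) (n : ℤ) (u : homDG P (shiftObj N n)) :
    (homShiftIso P N n).hom.lin u = shiftEquiv (homDG P N) n (homShiftEquiv P N n u) := rfl

theorem shiftMap_lin {M N : DGModule A} (f : M ⟶ N) (n : ℤ) (x : shiftObj M n) :
    Hom.lin (f⟦n⟧') x = shiftEquiv N n (f.lin ((shiftEquiv M n).symm x)) := rfl

theorem homTot_ext {P N : DGModule A} {u v : homDG P N} (h : ∀ p, u.1 p = v.1 p) : u = v :=
  Subtype.ext (LinearMap.ext h)

theorem homShiftEquiv_apply (P N : DGModule A) (n : ℤ) (u : homDG P (shiftObj N n)) (p : P) :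
    (homShiftEquiv P N n u).1 p = (shiftEquiv N n).symm (u.1 p) := rfl

theorem homFunctor_map_apply (P : DGModule A) {M N : DGModule A} (f : M ⟶ N) (u : homDG P M)
    (p : P) : (Hom.lin ((homFunctor P).map f) u).1 p = f.lin (u.1 p) := rfl

theorem homShiftEquiv_add (P N : DGModule A) (n m : ℤ) (u : homDG P (shiftObj N (n + m))) :
    homShiftEquiv P N n (homShiftEquiv P (shiftObj N n) m
      (((homFunctor P).map ((shiftFunctorAdd (DGModule A) n m).hom.app N)).lin u)) =
      homShiftEquiv P N (n + m) u :=
  homTot_ext fun p => (homShiftEquiv_apply P N n _ p).trans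
    ((congrArg (shiftEquiv N n).symm ((homShiftEquiv_apply P (shiftObj N n) m _ p).trans
      ((congrArg (shiftEquiv (shiftObj N n) m).symm
        ((homFunctor_map_apply P _ u p).trans (shiftAdd_hom_lin N n m (u.1 p)))).trans
          (LinearEquiv.symm_apply_apply _ _)))).trans (LinearEquiv.symm_apply_apply _ _))

theorem homShiftIso_add (P N : DGModule A) (n m : ℤ) :
    (homShiftIso P N (n + m)).hom =
      (homFunctor P).map ((shiftFunctorAdd (DGModule A) n m).hom.app N) ≫
        (homShiftIso P (shiftObj N n) m).hom ≫ (homShiftIso P N n).hom⟦m⟧' ≫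
          (shiftFunctorAdd (DGModule (endDG P)) n m).inv.app (homDG P N) := by
  refine hom_ext fun u => ?_
  refine (homShiftIso_lin P N (n + m) u).trans ?_
  refine (congrArg (shiftEquiv (homDG P N) (n + m)) (homShiftEquiv_add P N n m u)).symm.trans ?_
  exact (shiftAdd_inv_lin (homDG P N) n m _).symm

instance (P : DGModule A) : (homFunctor P).CommShift ℤ where
  commShiftIso n := NatIso.ofComponents (fun N => homShiftIso P N n) (fun _ => rfl)
  commShiftIso_zero := by
    ext N
    exact hom_ext fun f => rfl
  commShiftIso_add n m := by
    ext N
    rw [Functor.CommShift.isoAdd_hom_app]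
    exact homShiftIso_add P N n m

theorem homFunctor_commShift_hom (P N : DGModule A) (n : ℤ) :
    ((homFunctor P).commShiftIso n).hom.app N = (homShiftIso P N n).hom := rfl

/-- The projection of the mapping cone onto the source of the map, which has degree `1`. -/
def coneFst {M N : DGModule A} (f : M ⟶ N) : cone f →ₗ[Aᵐᵒᵖ] M := LinearMap.fst Aᵐᵒᵖ M N

/-- The projection of the mapping cone onto the target of the map. -/
def coneSnd {M N : DGModule A} (f : M ⟶ N) : cone f →ₗ[Aᵐᵒᵖ] N := LinearMap.snd Aᵐᵒᵖ M N

theorem coneFst_mem {M N : DGModule A} (f : M ⟶ N) : coneFst f ∈ homDeg (cone f) M 1 :=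
  fun _ _ h => h.1

theorem coneSnd_mem {M N : DGModule A} (f : M ⟶ N) : coneSnd f ∈ homDeg (cone f) N 0 :=
  fun i m h => by rw [add_zero]; exact h.2

theorem homD_coneFst {M N : DGModule A} (f : M ⟶ N) : homD (cone f) M (coneFst f) = 0 :=
  LinearMap.ext fun m => by
    rw [homD_of_mem (coneFst_mem f)]
    change M.d (coneFst f m) - sgn 1 • - M.d (coneFst f m) = 0
    simp [sgn_one]

theorem homD_coneSnd {M N : DGModule A} (f : M ⟶ N) :
    homD (cone f) N (coneSnd f) = - (f.lin ∘ₗ coneFst f) :=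
  LinearMap.ext fun m => by
    rw [homD_of_mem (coneSnd_mem f)]
    change N.d (coneSnd f m) - sgn 0 • (f.lin (coneFst f m) + N.d (coneSnd f m)) =
      - f.lin (coneFst f m)
    simp [sgn_zero]

/-- The inclusion of the source in the mapping cone, which has degree `-1`. -/
def coneInl {M N : DGModule A} (f : M ⟶ N) : M →ₗ[Aᵐᵒᵖ] cone f := LinearMap.inl Aᵐᵒᵖ M N

theorem coneInl_mem {M N : DGModule A} (f : M ⟶ N) : coneInl f ∈ homDeg M (cone f) (-1) :=
  fun i m h => ⟨by
    change m ∈ M.gr (i + -1 + 1)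
    rwa [neg_add_cancel_right], zero_mem _⟩

theorem cone_ext {M N : DGModule A} (f : M ⟶ N) {m m' : cone f} (h₁ : coneFst f m = coneFst f m')
    (h₂ : coneSnd f m = coneSnd f m') : m = m' := Prod.ext h₁ h₂

theorem cone_mem {M N : DGModule A} (f : M ⟶ N) {i : ℤ} {m : cone f} :
    m ∈ (cone f).gr i ↔ coneFst f m ∈ M.gr (i + 1) ∧ coneSnd f m ∈ N.gr i := Iff.rfl

theorem coneSplit {M N : DGModule A} (f : M ⟶ N) (m : cone f) :
    coneInl f (coneFst f m) + (coneIn f).lin (coneSnd f m) = m :=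
  Prod.ext (add_zero (coneFst f m)) (zero_add (coneSnd f m))

theorem coneFst_split {M N : DGModule A} (f : M ⟶ N) (m : M) (n : N) :
    coneFst f (coneInl f m + (coneIn f).lin n) = m := add_zero m

theorem coneSnd_split {M N : DGModule A} (f : M ⟶ N) (m : M) (n : N) :
    coneSnd f (coneInl f m + (coneIn f).lin n) = n := zero_add n

theorem coneFst_d {M N : DGModule A} (f : M ⟶ N) (m : cone f) :
    coneFst f ((cone f).d m) = - M.d (coneFst f m) := rfl

theorem coneSnd_d {M N : DGModule A} (f : M ⟶ N) (m : cone f) :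
    coneSnd f ((cone f).d m) = f.lin (coneFst f m) + N.d (coneSnd f m) := rfl

/-- The map `Hom(P, cone f) ⟶ cone (Hom(P, f))`. -/
def homConeLin (P : DGModule A) {M N : DGModule A} (f : M ⟶ N) :
    homDG P (cone f) →ₗ[(endDG P)ᵐᵒᵖ] cone (homMap P f) :=
  coneInl _ ∘ₗ homPost P _ (coneFst_mem f) +
    (coneIn (homMap P f)).lin ∘ₗ homPost P _ (coneSnd_mem f)

theorem coneFst_homConeLin (P : DGModule A) {M N : DGModule A} (f : M ⟶ N)
    (u : homDG P (cone f)) :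
    coneFst _ (homConeLin P f u) = homPost P _ (coneFst_mem f) u := coneFst_split _ _ _

theorem coneSnd_homConeLin (P : DGModule A) {M N : DGModule A} (f : M ⟶ N)
    (u : homDG P (cone f)) :
    coneSnd _ (homConeLin P f u) = homPost P _ (coneSnd_mem f) u := coneSnd_split _ _ _

/-- The linear isomorphism `Hom(P, cone f) ≃ cone (Hom(P, f))`. -/
def homConeEquiv (P : DGModule A) {M N : DGModule A} (f : M ⟶ N) :
    homDG P (cone f) ≃ₗ[(endDG P)ᵐᵒᵖ] cone (homMap P f) :=
  LinearEquiv.ofLinearMap (homConeLin P f)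
    (homPost P _ (coneInl_mem f) ∘ₗ coneFst (homMap P f) +
      homPost P _ (lin_mem_homDeg (coneIn f)) ∘ₗ coneSnd (homMap P f))
    (LinearMap.ext fun v => cone_ext _
      ((coneFst_homConeLin P f _).trans (Subtype.ext (LinearMap.ext fun m =>
        coneFst_split f ((coneFst _ v).1 m) ((coneSnd _ v).1 m))))
      ((coneSnd_homConeLin P f _).trans (Subtype.ext (LinearMap.ext fun m =>
        coneSnd_split f ((coneFst _ v).1 m) ((coneSnd _ v).1 m)))))
    (LinearMap.ext fun u => by
      refine (congrArg₂ (fun x y => homPost P _ (coneInl_mem f) x +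
        homPost P _ (lin_mem_homDeg (coneIn f)) y) (coneFst_homConeLin P f u)
          (coneSnd_homConeLin P f u)).trans ?_
      exact Subtype.ext (LinearMap.ext fun m => coneSplit f (u.1 m)))

theorem homConeLin_d (P : DGModule A) {M N : DGModule A} (f : M ⟶ N) (u : homDG P (cone f)) :
    homConeLin P f ((homDG P (cone f)).d u) =
      (cone (homMap P f)).d (homConeLin P f u) := by
  have h₁ := homD_comp (coneFst_mem f) (P := P) u.1
  have h₂ := homD_comp (coneSnd_mem f) (P := P) u.1
  rw [homD_coneFst, LinearMap.zero_comp, zero_add, sgn_one, neg_one_smul] at h₁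
  rw [homD_coneSnd, sgn_zero, one_smul, LinearMap.neg_comp] at h₂
  refine cone_ext _ ?_ ?_
  · rw [coneFst_d, coneFst_homConeLin, coneFst_homConeLin]
    exact Subtype.ext (neg_eq_iff_eq_neg.1 h₁.symm)
  · rw [coneSnd_d, coneFst_homConeLin, coneSnd_homConeLin, coneSnd_homConeLin]
    exact Subtype.ext (neg_add_eq_iff_eq_add.1 h₂.symm)

theorem homConeLin_mem (P : DGModule A) {M N : DGModule A} (f : M ⟶ N) (i : ℤ)
    (u : homDG P (cone f)) :
    u ∈ (homDG P (cone f)).gr i ↔ homConeLin P f u ∈ (cone (homMap P f)).gr i := by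
  rw [cone_mem, coneFst_homConeLin, coneSnd_homConeLin]
  change (∀ j, ∀ m ∈ P.gr j, u.1 m ∈ (cone f).gr (j + i)) ↔
        (∀ j, ∀ m ∈ P.gr j, coneFst f (u.1 m) ∈ M.gr (j + (i + 1))) ∧
        (∀ j, ∀ m ∈ P.gr j, coneSnd f (u.1 m) ∈ N.gr (j + i))
  simp only [← add_assoc]
  exact ⟨fun h => ⟨fun j m hm => (h j m hm).1, fun j m hm => (h j m hm).2⟩,
    fun h j m hm => ⟨h.1 j m hm, h.2 j m hm⟩⟩

/-- The isomorphism `Hom(P, cone f) ≅ cone (Hom(P, f))`. -/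
def homConeIso (P : DGModule A) {M N : DGModule A} (f : M ⟶ N) :
    homDG P (cone f) ≅ cone (homMap P f) :=
  isoOfEq _ _ (homConeEquiv P f) (homConeLin_mem P f) (homConeLin_d P f)

end DGModule

/-- The functor `Hom(P, -)` between homotopy categories. -/
def homK (P : DGModule A) : HomotopyCat A ⥤ HomotopyCat (endDG P) :=
  CategoryTheory.Quotient.lift (homotopic A) (homFunctor P ⋙ toK (endDG P))
    fun _ _ _ _ h => toK_eq (homotopic_homFunctor P h)

instance (P : DGModule A) : (homK P).CommShift ℤ :=
  inferInstanceAs ((CategoryTheory.Quotient.lift (homotopic A) (homFunctor P ⋙ toK (endDG P))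
    fun _ _ _ _ h => toK_eq (homotopic_homFunctor P h)).CommShift ℤ)

/-- The compatibility of `Hom(P, -)` with the passage to homotopy categories. -/
def homKIso (P : DGModule A) : toK A ⋙ homK P ≅ homFunctor P ⋙ toK (endDG P) :=
  CategoryTheory.Quotient.lift.isLift (homotopic A) (homFunctor P ⋙ toK (endDG P))
    fun _ _ _ _ h => toK_eq (homotopic_homFunctor P h)

instance (P : DGModule A) : NatTrans.CommShift (homKIso P).hom ℤ :=
  CategoryTheory.Quotient.liftCommShift_compatibility _ _ _ _

instance (P : DGModule A) : (homFunctor P).Additive where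
  map_add := hom_ext fun _ => Subtype.ext (LinearMap.add_comp _ _ _)

/-- The image by `Hom(P, -)` of a standard triangle is a standard triangle. -/
def homTriangleIso (P : DGModule A) {M N : DGModule A} (f : M ⟶ N) :
    (homFunctor P).mapTriangle.obj (coneTriangle f) ≅ coneTriangle (homMap P f) :=
  Triangle.isoMk _ _ (Iso.refl _) (Iso.refl _) (homConeIso P f)
    ((Category.comp_id _).trans (Category.id_comp _).symm)
    (hom_ext fun (_ : homTot P N) => cone_ext (homMap P f)
      ((coneFst_homConeLin P f _).trans (Subtype.ext (LinearMap.ext fun _ => rfl)))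
      ((coneSnd_homConeLin P f _).trans (Subtype.ext (LinearMap.ext fun _ => rfl))))
    (hom_ext fun (u : homTot P (cone f)) => (coneFst_homConeLin P f u).symm)

instance (P : DGModule A) : (homK P).IsTriangulated where
  map_distinguished := by
    rintro T ⟨M, N, f, ⟨e⟩⟩
    exact ⟨_, _, homMap P f, ⟨(homK P).mapTriangle.mapIso e ≪≫
      (Functor.mapTriangleCompIso (toK A) (homK P)).symm.app _ ≪≫
      (Functor.mapTriangleIso (homKIso P)).app _ ≪≫
      (Functor.mapTriangleCompIso (homFunctor P) (toK (endDG P))).app _ ≪≫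
      (toK (endDG P)).mapTriangle.mapIso (homTriangleIso P f)⟩⟩

theorem homK_inverts (P : DGModule A) (hP : P.IsHProjective) :
    (acyclicK A).trW.IsInvertedBy (homK P ⋙ qD (endDG P)) := by
  rintro X Y f ⟨Z, g, h, hT, hZ⟩
  refine Localization.inverts (qD (endDG P)) (acyclicK (endDG P)).trW _
    ⟨_, _, _, (homK P).map_distinguished _ hT, ?_⟩
  exact hP _ hZ

/-- The derived functor `RHom(P, -)` from the derived category of `A` to that of the DG algebra of
endomorphisms of the h-projective module `P`, computed by `Hom(P, -)`. -/
def RHom (P : DGModule A) (hP : P.IsHProjective) : DerivedCat A ⥤ DerivedCat (endDG P) :=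
  Localization.lift (homK P ⋙ qD (endDG P)) (homK_inverts P hP) (qD A)

/-- `RHom(P, -)` is computed by `Hom(P, -)` on all DG modules. -/
def RHomIso (P : DGModule A) (hP : P.IsHProjective) :
    qD A ⋙ RHom P hP ≅ homK P ⋙ qD (endDG P) :=
  Localization.Lifting.iso (qD A) (acyclicK A).trW (homK P ⋙ qD (endDG P))
    (Localization.lift (homK P ⋙ qD (endDG P)) (homK_inverts P hP) (qD A))

instance (P : DGModule A) (hP : P.IsHProjective) : Localization.Lifting (qD A)
    (acyclicK A).trW (homK P ⋙ qD (endDG P)) (RHom P hP) := ⟨RHomIso P hP⟩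

instance (P : DGModule A) (hP : P.IsHProjective) : (RHom P hP).CommShift ℤ :=
  Functor.commShiftOfLocalization (qD A) (acyclicK A).trW ℤ (homK P ⋙ qD (endDG P)) (RHom P hP)

instance (P : DGModule A) (hP : P.IsHProjective) : NatTrans.CommShift (RHomIso P hP).hom ℤ :=
  NatTrans.commShift_iso_hom_of_localization (qD A) (acyclicK A).trW ℤ (homK P ⋙ qD (endDG P))
    (RHom P hP)

instance (P : DGModule A) (hP : P.IsHProjective) : (RHom P hP).IsTriangulated := by
  have := Localization.essSurj_mapArrow (qD A) (acyclicK A).trW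
  exact Functor.isTriangulated_of_precomp_iso (RHomIso P hP)

/-- The DG algebra `A` as a right DG module over itself. -/
def DGAlgebra.regular (A : DGAlgebra k) : DGModule A where
  carrier := A
  gr := A.gr
  isInternal := A.isInternal
  smul_mem := A.mul_mem
  d := A.d
  d_mem := A.d_mem
  d_d := A.d_d
  leibniz := A.leibniz

variable (A) in
/-- The perfect objects of the derived category: the smallest triangulated subcategory that
contains `A` and is closed under direct summands. -/
def Perf : ObjectProperty (DerivedCat A) :=
  (ObjectProperty.singleton ((toD A).obj A.regular)).triangEnvelope

end

/-!
Let `P` be an h-projective module isomorphic to `πup A` in `D(B)`. The functor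
`φ = RHom(P, -) ∘ πup` is an equivalence because it preserves coproducts, maps the localizing
generator `A` of `D(A)` to the localizing generator `End(P)` of `D(End(P))`, and is bijective on
morphisms out of `A` (`isEquivalence_of_isLocalizingGenerator`): the objects `M` such that `φ` is
bijective on all morphisms out of `M` form a localizing subcategory by the five lemma, so `φ` is fully
faithful, and then its essential image is a localizing subcategory that contains the generator of the
target.

Bijectivity on morphisms out of `A` holds for `πup`, which is fully faithful because `πlow ∘ πup` is
isomorphic to the identity, and for `RHom(P, -)` at `P` (`bijectiveFrom_RHom`): since `P` and
`Hom(P, P) = End(P)` are h-projective, both sides can be computed in the homotopy categories, where a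
morphism `Hom(P, P) ⟶ Hom(P, N)` is the composition with its value at the identity.

That `RHom(P, -)` preserves coproducts is the compactness of `P`
(`preservesCoproducts_of_isCompactObj`). It holds because `A` is compact in `D(A)` and the right
adjoint `πlow` of `πup` preserves coproducts.

The facts about derived categories come from h-projective resolutions. The homotopy category has
direct sums as coproducts and `A` is compact in it, so that every module `M` receives a morphism from
an object of the localizing subcategory generated by `A` which induces an isomorphism on cohomology
(`exists_localizing_approximation`, by a homotopy colimit). The modules without morphisms to acyclic
ones are the h-projective ones; they form a localizing subcategory containing `A`, so each module has
an h-projective resolution. Morphisms out of h-projective modules in the derived category are those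
of the homotopy category, whence the coproducts of `D(A)`, the compactness of `A` and the fact that
`A` is a localizing generator of `D(A)`.
-/

universe w v₁ v₂ u₁ u₂

noncomputable section

/-! ### Compact objects and coproducts in additive categories -/

section Compact

variable {C : Type u₁} [Category.{v₁} C] [Preadditive C] {D : Type u₂} [Category.{v₂} D]
  [Preadditive D]

/-- An object `G` is compact if every morphism from `G` to a coproduct indexed by a type in `Type w`
is a finite sum of morphisms that factor through the summands. In an additive category this is
equivalent to the bijectivity of `⨁ j, Hom(G, X j) ⟶ Hom(G, ∐ X)`, which is injective anyway. -/
def IsCompactObj (G : C) : Prop :=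
  ∀ ⦃J : Type w⦄ ⦃X : J → C⦄ (c : Cofan X) (_ : IsColimit c) (f : G ⟶ c.pt),
    ∃ (s : Finset J) (g : ∀ j, G ⟶ X j), f = ∑ j ∈ s, g j ≫ c.inj j

/-- Compactness can be tested on one chosen coproduct of each family. -/
theorem isCompactObj_of_exists {G : C} (h : ∀ ⦃J : Type w⦄ (X : J → C), ∃ c : Cofan X,
    Nonempty (IsColimit c) ∧ ∀ f : G ⟶ c.pt,
      ∃ (s : Finset J) (g : ∀ j, G ⟶ X j), f = ∑ j ∈ s, g j ≫ c.inj j) :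
    IsCompactObj.{w} G := fun J X c hc f => by
  obtain ⟨c', ⟨hc'⟩, h⟩ := h X
  let e := hc.coconePointUniqueUpToIso hc'
  obtain ⟨s, g, hg⟩ := h (f ≫ e.hom)
  refine ⟨s, g, ?_⟩
  rw [← cancel_mono e.hom, hg, Preadditive.sum_comp]
  refine Finset.sum_congr rfl fun j _ => ?_
  rw [Category.assoc]
  exact congrArg (g j ≫ ·) (hc.comp_coconePointUniqueUpToIso_hom hc' ⟨j⟩).symm

theorem IsCompactObj.of_iso {G H : C} (hG : IsCompactObj.{w} G) (e : G ≅ H) :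
    IsCompactObj.{w} H := fun J X c hc f => by
  obtain ⟨s, g, hg⟩ := hG c hc (e.hom ≫ f)
  refine ⟨s, fun j => e.inv ≫ g j, ?_⟩
  simp only [Category.assoc, ← Preadditive.comp_sum, ← hg, Iso.inv_hom_id_assoc]

/-- A left adjoint preserves compact objects if its right adjoint preserves coproducts. -/
theorem IsCompactObj.of_adjunction {G : C} (hG : IsCompactObj.{w} G) {L : C ⥤ D} {R : D ⥤ C}
    [L.Additive] (adj : L ⊣ R) (hR : ∀ J : Type w, PreservesColimitsOfShape (Discrete J) R) :
    IsCompactObj.{w} (L.obj G) := fun J X c hc f => by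
  have := hR J
  obtain ⟨s, g, hg⟩ := hG _ (isColimitCofanMkObjOfIsColimit R X c.inj
    (hc.ofIsoColimit (Cofan.ext (Iso.refl _)))) (adj.homEquiv _ _ f)
  refine ⟨s, fun j => (adj.homEquiv _ _).symm (g j), ?_⟩
  rw [← (adj.homEquiv _ _).symm_apply_apply f, hg, Adjunction.homEquiv_counit, Functor.map_sum,
    Preadditive.sum_comp]
  exact Finset.sum_congr rfl fun j _ => by simp [Adjunction.homEquiv_counit]

theorem IsCompactObj.shift [HasShift C ℤ] [∀ n : ℤ, (shiftFunctor C n).Additive] {G : C}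
    (hG : IsCompactObj.{w} G) (n : ℤ) : IsCompactObj.{w} (G⟦n⟧) :=
  hG.of_adjunction (shiftEquiv C n).toAdjunction
    fun J => (inferInstance : PreservesColimitsOfShape (Discrete J) (shiftEquiv C n).inverse)

open Classical in
/-- The projection of a coproduct onto one of its summands. -/
def cofanProj {J : Type w} {X : J → C} {c : Cofan X} (hc : IsColimit c) (j : J) :
    c.pt ⟶ X j :=
  Cofan.IsColimit.desc hc fun i => if h : i = j then eqToHom (congrArg X h) else 0

theorem inj_cofanProj_self {J : Type w} {X : J → C} {c : Cofan X} (hc : IsColimit c) (j : J) :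
    c.inj j ≫ cofanProj hc j = 𝟙 _ := by
  simp [cofanProj]

theorem inj_cofanProj_ne {J : Type w} {X : J → C} {c : Cofan X} (hc : IsColimit c) {i j : J}
    (h : i ≠ j) : c.inj i ≫ cofanProj hc j = 0 := by
  simp [cofanProj, h]

theorem sum_inj_cofanProj {J : Type w} {X : J → C} {c : Cofan X} (hc : IsColimit c) {G : C}
    (s : Finset J) (g : ∀ j, G ⟶ X j) {j : J} (hj : j ∈ s) :
    (∑ i ∈ s, g i ≫ c.inj i) ≫ cofanProj hc j = g j := by
  rw [Preadditive.sum_comp, Finset.sum_eq_single_of_mem j hj fun i _ hi => by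
    rw [Category.assoc, inj_cofanProj_ne hc hi, comp_zero]]
  rw [Category.assoc, inj_cofanProj_self, Category.comp_id]

theorem IsCompactObj.eq_zero {G : C} (hG : IsCompactObj.{w} G) {J : Type w} {X : J → C}
    {c : Cofan X} (hc : IsColimit c) (f : G ⟶ c.pt) (h : ∀ j, f ≫ cofanProj hc j = 0) :
    f = 0 := by
  obtain ⟨s, g, rfl⟩ := hG c hc f
  refine Finset.sum_eq_zero fun j hj => ?_
  rw [← sum_inj_cofanProj hc s g hj, h, zero_comp]

end Compact

/-! ### Homotopy colimits and approximation by objects of a localizing subcategory -/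

section Approximation

variable {C : Type u₁} [Category.{v₁} C] [HasShift C ℤ] [Preadditive C]
  [∀ n : ℤ, (shiftFunctor C n).Additive]

theorem hom_shift_eq_zero {G X : C} (hX : ∀ (n : ℤ) (f : G⟦n⟧ ⟶ X), f = 0) (n : ℤ)
    (f : G ⟶ X⟦n⟧) : f = 0 := by
  have h := hX (-n) (f⟦-n⟧' ≫ (shiftShiftNeg X n).hom)
  rwa [Preadditive.IsIso.comp_right_eq_zero, Functor.map_eq_zero_iff] at h

theorem injective_shift {G X Y : C} (d : X ⟶ Y)
    (hd : ∀ (n : ℤ) (f : G⟦n⟧ ⟶ X), f ≫ d = 0 → f = 0) (n : ℤ) (f : G⟦n⟧ ⟶ X⟦(1 : ℤ)⟧)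
    (hf : f ≫ d⟦(1 : ℤ)⟧' = 0) : f = 0 := by
  let e := (shiftFunctorAdd' C (n - 1) 1 n (by omega)).app G
  obtain ⟨g, hg⟩ := (shiftFunctor C (1 : ℤ)).map_surjective (e.inv ≫ f)
  have h : g ≫ d = 0 := (shiftFunctor C (1 : ℤ)).map_injective (by
    rw [Functor.map_comp, hg, Category.assoc, hf, comp_zero, Functor.map_zero])
  rw [← cancel_epi e.inv, comp_zero]
  exact hg.symm.trans (by rw [hd _ _ h, Functor.map_zero])

variable [HasZeroObject C] [Pretriangulated C] [HasCoproducts.{w} C] (Q : ObjectProperty C)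
  [Q.IsTriangulated] [Q.IsClosedUnderIsomorphisms]
  [∀ J : Type w, Q.IsClosedUnderColimitsOfShape (Discrete J)]
  {G : C}

/-- The homotopy colimit of a sequence `X 0 ⟶ X 1 ⟶ ⋯` over `M` is the cone of
`1 - shift : ∐ X ⟶ ∐ X`. Morphisms from a compact object to it are the colimit of the morphisms to
the terms of the sequence. -/
theorem exists_bijective_of_sequence (hG : IsCompactObj.{w} G) {X : ℕ → C}
    (t : ∀ i, X i ⟶ X (i + 1)) {M : C} (a : ∀ i, X i ⟶ M) (hta : ∀ i, t i ≫ a (i + 1) = a i)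
    (hsurj : ∀ (n : ℤ) (f : G⟦n⟧ ⟶ M), ∃ g : G⟦n⟧ ⟶ X 0, g ≫ a 0 = f)
    (hker : ∀ i (n : ℤ) (f : G⟦n⟧ ⟶ X i), f ≫ a i = 0 → f ≫ t i = 0) (hQ : ∀ i, Q (X i)) :
    ∃ (H : C) (p : H ⟶ M), Q H ∧
      ∀ n : ℤ, Function.Bijective (fun f : G⟦n⟧ ⟶ H => f ≫ p) := by
  let X' : ULift.{w} ℕ → C := fun j => X j.down
  let S : Cofan X' := Cofan.mk (∐ X') (Sigma.ι X')
  let hS : IsColimit S := coproductIsCoproduct X'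
  let ι (i : ℕ) : X i ⟶ S.pt := S.inj ⟨i⟩
  let π (i : ℕ) : S.pt ⟶ X i := cofanProj hS ⟨i⟩
  have hom_ext {Y : C} {f g : S.pt ⟶ Y} (h : ∀ i, ι i ≫ f = ι i ≫ g) : f = g :=
    Cofan.IsColimit.hom_ext hS _ _ fun j => h j.down
  have ιπ (i : ℕ) : ι i ≫ π i = 𝟙 _ := inj_cofanProj_self hS _
  have ιπ' {i j : ℕ} (h : i ≠ j) : ι i ≫ π j = 0 :=
    inj_cofanProj_ne hS fun h' => h (congrArg ULift.down h')
  let sh : S.pt ⟶ S.pt := Cofan.IsColimit.desc hS fun j => t j.down ≫ ι (j.down + 1)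
  have ιsh (i : ℕ) : ι i ≫ sh = t i ≫ ι (i + 1) := Cofan.IsColimit.fac hS _ ⟨i⟩
  have sh0 : sh ≫ π 0 = 0 := hom_ext fun i => by
    rw [reassoc_of% ιsh, ιπ' (by omega), comp_zero, comp_zero]
  have shs (j : ℕ) : sh ≫ π (j + 1) = π j ≫ t j := hom_ext fun i => by
    rw [reassoc_of% ιsh]
    by_cases h : i = j
    · subst h
      rw [ιπ, reassoc_of% ιπ, Category.comp_id]
    · rw [ιπ' (by omega), reassoc_of% ιπ' h, comp_zero, zero_comp]
  obtain ⟨H, c, δ, hT⟩ := distinguished_cocone_triangle (𝟙 S.pt - sh)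
  have ιc (i : ℕ) : ι i ≫ c = t i ≫ ι (i + 1) ≫ c := by
    have h := ι i ≫= comp_distTriang_mor_zero₁₂ _ hT
    change ι i ≫ (𝟙 S.pt - sh) ≫ c = ι i ≫ 0 at h
    rwa [Preadditive.sub_comp, Preadditive.comp_sub, Category.id_comp, reassoc_of% ιsh, comp_zero,
      sub_eq_zero] at h
  let b : S.pt ⟶ M := Cofan.IsColimit.desc hS fun j => a j.down
  have ιb (i : ℕ) : ι i ≫ b = a i := Cofan.IsColimit.fac hS _ ⟨i⟩
  obtain ⟨p, hp⟩ : ∃ p : H ⟶ M, b = c ≫ p := Triangle.yoneda_exact₂ _ hT b (hom_ext fun i => by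
    change ι i ≫ (𝟙 S.pt - sh) ≫ b = ι i ≫ 0
    rw [Preadditive.sub_comp, Preadditive.comp_sub, Category.id_comp, reassoc_of% ιsh, ιb, ιb, hta,
      sub_self, comp_zero])
  have hd (n : ℤ) (f : G⟦n⟧ ⟶ S.pt) (hf : f ≫ (𝟙 S.pt - sh) = 0) : f = 0 := by
    rw [Preadditive.comp_sub, Category.comp_id, sub_eq_zero] at hf
    have key (j : ℕ) : f ≫ π j = 0 := by
      induction j with
      | zero => rw [hf, Category.assoc, sh0, comp_zero]
      | succ j hj => rw [hf, Category.assoc, shs, reassoc_of% hj, zero_comp]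
    exact (hG.shift n).eq_zero hS f fun j => key j.down
  have late (n : ℤ) (i N : ℕ) (h : i ≤ N) (g : G⟦n⟧ ⟶ X i) :
      ∃ f : G⟦n⟧ ⟶ X N, g ≫ ι i ≫ c = f ≫ ι N ≫ c := by
    induction N, h using Nat.le_induction with
    | base => exact ⟨g, rfl⟩
    | succ N _ ih =>
      obtain ⟨f, hf⟩ := ih
      exact ⟨f ≫ t N, by rw [hf, ιc, Category.assoc]⟩
  -- A morphism to the homotopy colimit that lifts to `∐ X` factors through all late terms.
  have factors (n : ℤ) (s : Finset (ULift.{w} ℕ)) (g : ∀ j, G⟦n⟧ ⟶ X' j) :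
      ∃ N₀, ∀ N ≥ N₀, ∃ f : G⟦n⟧ ⟶ X N, (∑ j ∈ s, g j ≫ S.inj j) ≫ c = f ≫ ι N ≫ c := by
    induction s using Finset.cons_induction with
    | empty => exact ⟨0, fun N _ => ⟨0, by simp⟩⟩
    | cons j s hj ih =>
      obtain ⟨N₀, hN₀⟩ := ih
      refine ⟨max N₀ j.down, fun N hN => ?_⟩
      obtain ⟨f, hf⟩ := hN₀ N (le_trans (le_max_left _ _) hN)
      obtain ⟨f', hf'⟩ := late n j.down N (le_trans (le_max_right _ _) hN) (g j)
      exact ⟨f' + f, by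
        rw [Finset.sum_cons, Preadditive.add_comp, hf, Preadditive.add_comp, ← hf', Category.assoc]⟩
  refine ⟨H, p, ?_, fun n => ⟨?_, fun f => ?_⟩⟩
  · have : Q S.pt := Q.prop_of_isColimit hS fun j => hQ j.as.down
    exact Q.ext_of_isTriangulatedClosed₃ _ hT this this
  · suffices ∀ f : G⟦n⟧ ⟶ H, f ≫ p = 0 → f = 0 from fun f f' h =>
      sub_eq_zero.1 (this _ (by rw [Preadditive.sub_comp, sub_eq_zero]; exact h))
    intro f hf
    have hδ : f ≫ δ = 0 := injective_shift _ hd n _ (by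
      have := comp_distTriang_mor_zero₃₁ _ hT
      change δ ≫ (𝟙 S.pt - sh)⟦(1 : ℤ)⟧' = 0 at this
      rw [Category.assoc, this, comp_zero])
    obtain ⟨f', rfl⟩ : ∃ f' : G⟦n⟧ ⟶ S.pt, f = f' ≫ c := Triangle.coyoneda_exact₃ _ hT f hδ
    obtain ⟨s, g, rfl⟩ := hG.shift n S hS f'
    obtain ⟨N, hN⟩ := factors n s g
    obtain ⟨f, h⟩ := hN N le_rfl
    rw [h] at hf ⊢
    rw [Category.assoc, Category.assoc, ← hp, ιb] at hf
    rw [ιc, reassoc_of% hker N n f hf, zero_comp]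
  · obtain ⟨g, rfl⟩ := hsurj n f
    exact ⟨g ≫ ι 0 ≫ c, by
      change (g ≫ ι 0 ≫ c) ≫ p = _
      rw [Category.assoc, Category.assoc, ← hp, ιb]⟩

end Approximation

section Brown

variable {C : Type u₁} [Category.{w} C] [HasZeroObject C] [HasShift C ℤ] [Preadditive C]
  [∀ n : ℤ, (shiftFunctor C n).Additive] [Pretriangulated C]
  [HasCoproducts.{w} C] (Q : ObjectProperty C) [Q.IsTriangulated]
  [Q.IsClosedUnderIsomorphisms] [∀ J : Type w, Q.IsClosedUnderColimitsOfShape (Discrete J)]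
  {G : C}

/-- Every object receives a morphism from an object of the localizing subcategory `Q` that cannot be
distinguished from an isomorphism by the shifts of the compact object `G` of `Q`. The morphism is
the homotopy colimit of a sequence that starts with a coproduct of shifts of `G`, and in each step of
which all morphisms from shifts of `G` that should vanish are killed. -/
theorem exists_localizing_approximation (hG : IsCompactObj.{w} G) (hQ : Q G) (M : C) :
    ∃ (X : C) (p : X ⟶ M), Q X ∧
      ∀ n : ℤ, Function.Bijective (fun f : G⟦n⟧ ⟶ X => f ≫ p) := by
  have step (X : C) (a : X ⟶ M) : ∃ (Y : C) (t : X ⟶ Y) (a' : Y ⟶ M), t ≫ a' = a ∧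
      (Q X → Q Y) ∧ ∀ (n : ℤ) (f : G⟦n⟧ ⟶ X), f ≫ a = 0 → f ≫ t = 0 := by
    let K : (Σ n : ℤ, { f : G⟦n⟧ ⟶ X // f ≫ a = 0 }) → C := fun j => G⟦j.1⟧
    let φ : ∐ K ⟶ X := Sigma.desc fun j => j.2.1
    obtain ⟨Y, t, δ, hT⟩ := distinguished_cocone_triangle φ
    obtain ⟨a', ha'⟩ : ∃ a' : Y ⟶ M, a = t ≫ a' := Triangle.yoneda_exact₂ _ hT a
      (Sigma.hom_ext _ _ fun j => by
        change Sigma.ι K j ≫ φ ≫ a = Sigma.ι K j ≫ 0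
        rw [Sigma.ι_desc_assoc, j.2.2, comp_zero])
    refine ⟨Y, t, a', ha'.symm, fun hX => Q.ext_of_isTriangulatedClosed₃ _ hT
      (Q.prop_colimit _ fun j => Q.le_shift _ _ hQ) hX, fun n f hf => ?_⟩
    have h₁ : Sigma.ι K ⟨n, f, hf⟩ ≫ φ = f := Sigma.ι_desc _ _
    have h₂ : φ ≫ t = 0 := comp_distTriang_mor_zero₁₂ _ hT
    rw [← h₁, Category.assoc, h₂, comp_zero]
  choose Y t a' h₁ h₂ h₃ using step
  let K : (Σ n : ℤ, (G⟦n⟧ ⟶ M)) → C := fun j => G⟦j.1⟧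
  let seq : ℕ → Σ X : C, (X ⟶ M) := fun n => n.rec ⟨∐ K, Sigma.desc fun j => j.2⟩
    fun _ p => ⟨Y p.1 p.2, a' p.1 p.2⟩
  refine exists_bijective_of_sequence Q hG (X := fun i => (seq i).1) (fun i => t _ _)
    (fun i => (seq i).2) (fun i => h₁ _ _) (fun n f => ⟨Sigma.ι K ⟨n, f⟩, Sigma.ι_desc _ _⟩)
    (fun i n f hf => h₃ _ _ n f hf) (fun i => ?_)
  induction i with
  | zero => exact Q.prop_colimit _ fun j => Q.le_shift _ _ hQ
  | succ i hi => exact h₂ _ _ hi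

end Brown

/-! ### Localizing generators -/

section BijectiveFrom

variable {C : Type u₁} [Category.{v₁} C] {D : Type u₂} [Category.{v₂} D]

theorem bijective_map_of_iso (F : C ⥤ D) {M N M' N' : C}
    (h : Function.Bijective (F.map : (M ⟶ N) → (F.obj M ⟶ F.obj N))) (e : M ≅ M') (e' : N ≅ N') :
    Function.Bijective (F.map : (M' ⟶ N') → (F.obj M' ⟶ F.obj N')) := by
  have : (F.map : (M' ⟶ N') → _) =
      (F.mapIso e).homCongr (F.mapIso e') ∘ F.map ∘ (e.homCongr e').symm := by
    ext f
    simp [Iso.homCongr, ← Functor.map_comp]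
  rw [this]
  exact (Equiv.bijective _).comp (h.comp (Equiv.bijective _))

theorem bijective_map_of_natIso {F F' : C ⥤ D} (e : F ≅ F') {M N : C}
    (h : Function.Bijective (F.map : (M ⟶ N) → (F.obj M ⟶ F.obj N))) :
    Function.Bijective (F'.map : (M ⟶ N) → (F'.obj M ⟶ F'.obj N)) := by
  have : (F'.map : (M ⟶ N) → _) = (e.app M).homCongr (e.app N) ∘ F.map := by
    ext f
    simp [Iso.homCongr]
  rw [this]
  exact (Equiv.bijective _).comp h

/-- The property of objects `M` that `F` is bijective on all morphisms from `M`. -/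
def bijectiveFrom (F : C ⥤ D) : ObjectProperty C :=
  fun M => ∀ N, Function.Bijective (F.map : (M ⟶ N) → (F.obj M ⟶ F.obj N))

instance (F : C ⥤ D) : (bijectiveFrom F).IsClosedUnderIsomorphisms where
  of_iso e h N := bijective_map_of_iso F (h N) e (Iso.refl N)

end BijectiveFrom

section Generator

variable {C : Type u₁} [Category.{v₁} C] [HasZeroObject C] [HasShift C ℤ] [Preadditive C]
  [∀ n : ℤ, (shiftFunctor C n).Additive] [Pretriangulated C]
  {D : Type u₂} [Category.{v₂} D] [HasZeroObject D] [HasShift D ℤ] [Preadditive D]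
  [∀ n : ℤ, (shiftFunctor D n).Additive] [Pretriangulated D]

/-- An object `G` is a localizing generator if the only strictly full triangulated subcategory that
contains `G` and is closed under coproducts indexed by types in `Type w` is the whole category. -/
def IsLocalizingGenerator (G : C) : Prop :=
  ∀ (Q : ObjectProperty C) [Q.IsTriangulated] [Q.IsClosedUnderIsomorphisms]
    [∀ J : Type w, Q.IsClosedUnderColimitsOfShape (Discrete J)], Q G → ∀ X, Q X

theorem IsLocalizingGenerator.of_iso {G H : C} (hG : IsLocalizingGenerator.{w} G) (e : G ≅ H) :
    IsLocalizingGenerator.{w} H := fun Q _ _ _ hH => hG Q (Q.prop_of_iso e.symm hH)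

instance leftOrthogonal_isClosedUnderColimitsOfShape (Q : ObjectProperty C) (J : Type w) :
    Q.leftOrthogonal.IsClosedUnderColimitsOfShape (Discrete J) where
  colimitsOfShape_le := by
    rintro X ⟨h⟩ Y f hY
    exact h.isColimit.hom_ext fun j => (h.prop_diag_obj j _ hY).trans comp_zero.symm

theorem IsLocalizingGenerator.isZero {G : C} (hG : IsLocalizingGenerator.{w} G) {X : C}
    (hX : ∀ (n : ℤ) (f : G⟦n⟧ ⟶ X), f = 0) : IsZero X := by
  rw [IsZero.iff_id_eq_zero]
  refine hG ((ObjectProperty.singleton X).shiftClosure ℤ).leftOrthogonal ?_ X _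
    (ObjectProperty.le_shiftClosure _ _ (by simp))
  rintro Y f ⟨Z, n, e, hZ⟩
  obtain rfl : X = Z := by simpa using hZ
  exact (cancel_mono e.hom).1 ((hom_shift_eq_zero hX _ _).trans zero_comp.symm)

theorem hom_cone_eq_zero {G X Y Z : C} {p : X ⟶ Y} {q : Y ⟶ Z} {δ : Z ⟶ X⟦(1 : ℤ)⟧}
    (hT : Triangle.mk p q δ ∈ distTriang C)
    (hp : ∀ n : ℤ, Function.Bijective (fun f : G⟦n⟧ ⟶ X => f ≫ p)) (n : ℤ) (f : G⟦n⟧ ⟶ Z) :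
    f = 0 := by
  have hδ : f ≫ δ = 0 := injective_shift p (fun n f hf => (hp n).1 (by simpa using hf)) _ _ (by
    have := comp_distTriang_mor_zero₃₁ _ hT
    change δ ≫ p⟦(1 : ℤ)⟧' = 0 at this
    rw [Category.assoc, this, comp_zero])
  obtain ⟨f', rfl⟩ : ∃ f' : G⟦n⟧ ⟶ Y, f = f' ≫ q := Triangle.coyoneda_exact₃ _ hT f hδ
  obtain ⟨g, rfl⟩ := (hp _).2 f'
  have : p ≫ q = 0 := comp_distTriang_mor_zero₁₂ _ hT
  change (g ≫ p) ≫ q = 0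
  rw [Category.assoc, this, comp_zero]

theorem IsLocalizingGenerator.isIso {G : C} (hG : IsLocalizingGenerator.{w} G) {X Y : C}
    (p : X ⟶ Y) (hp : ∀ n : ℤ, Function.Bijective (fun f : G⟦n⟧ ⟶ X => f ≫ p)) : IsIso p := by
  obtain ⟨Z, q, δ, hT⟩ := distinguished_cocone_triangle p
  refine (Triangle.isZero₃_iff_isIso₁ _ hT).1 (hG.isZero (hom_cone_eq_zero hT hp))

instance (F : C ⥤ D) [F.CommShift ℤ] : (bijectiveFrom F).IsStableUnderShift ℤ where
  isStableUnderShiftBy n := ⟨fun M h N => by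
    refine bijective_map_of_iso F (M := M⟦n⟧) (N := N⟦-n⟧⟦n⟧) ?_ (Iso.refl _) (shiftNegShift N n)
    let φ := ((F.commShiftIso n).app M).symm.homCongr ((F.commShiftIso n).app (N⟦-n⟧)).symm
    have : (F.map : (M⟦n⟧ ⟶ N⟦-n⟧⟦n⟧) → _) ∘ (shiftFunctor C n).map =
        φ ∘ (shiftFunctor D n).map ∘ (F.map : (M ⟶ N⟦-n⟧) → _) := by
      ext f
      simp [φ, Iso.homCongr]
    rw [← Function.Bijective.of_comp_iff _
      ⟨(shiftFunctor C n).map_injective, (shiftFunctor C n).map_surjective⟩, this]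
    exact φ.bijective.comp (Function.Bijective.comp
      ⟨(shiftFunctor D n).map_injective, (shiftFunctor D n).map_surjective⟩ (h _))⟩

/-- The five lemma for the long exact sequences of morphisms out of a distinguished triangle. -/
instance (F : C ⥤ D) [F.CommShift ℤ] [F.IsTriangulated] :
    (bijectiveFrom F).IsTriangulatedClosed₃ :=
  .mk' fun T hT h₁ h₂ N => by
    have hT' := F.map_distinguished _ hT
    have h₁' := (bijectiveFrom F).le_shift (1 : ℤ) _ h₁
    have h₂' := (bijectiveFrom F).le_shift (1 : ℤ) _ h₂
    have hgh : T.mor₁ ≫ T.mor₂ = 0 := comp_distTriang_mor_zero₁₂ _ hT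
    have hgf : T.mor₃ ≫ T.mor₁⟦(1 : ℤ)⟧' = 0 := comp_distTriang_mor_zero₃₁ _ hT
    -- Exactness of the image triangle, with the shift isomorphisms of `F` absorbed.
    have exact₁ {Z : D} (ψ : F.obj T.obj₃ ⟶ Z) (hψ : F.map T.mor₂ ≫ ψ = 0) :
        ∃ χ : F.obj (T.obj₁⟦(1 : ℤ)⟧) ⟶ Z, ψ = F.map T.mor₃ ≫ χ := by
      obtain ⟨χ, hχ⟩ := Triangle.yoneda_exact₃ _ hT' ψ hψ
      exact ⟨(F.commShiftIso (1 : ℤ)).hom.app _ ≫ χ, hχ.trans (Category.assoc _ _ _)⟩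
    have exact₂ {Z : D} (ψ : F.obj (T.obj₁⟦(1 : ℤ)⟧) ⟶ Z) (hψ : F.map T.mor₃ ≫ ψ = 0) :
        ∃ χ : F.obj (T.obj₂⟦(1 : ℤ)⟧) ⟶ Z, ψ = F.map (T.mor₁⟦(1 : ℤ)⟧') ≫ χ := by
      have h := F.map_distinguished _ (rot_of_distTriang _ (rot_of_distTriang _ hT))
      obtain ⟨χ, hχ⟩ := Triangle.yoneda_exact₂ _ h ψ hψ
      exact ⟨-χ, hχ.trans ((congrArg (· ≫ χ) (F.map_neg (f := T.mor₁⟦(1 : ℤ)⟧'))).trans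
        ((Preadditive.neg_comp _ _).trans (Preadditive.comp_neg _ _).symm))⟩
    refine ⟨fun φ φ' h => ?_, fun φ => ?_⟩
    · rw [← sub_eq_zero, ← Functor.map_sub] at h
      rw [← sub_eq_zero]
      generalize φ - φ' = φ at h
      obtain ⟨ψ, rfl⟩ := Triangle.yoneda_exact₃ _ hT φ ((h₂ N).1 (by
        rw [Functor.map_comp, h, comp_zero, Functor.map_zero]))
      rw [Functor.map_comp] at h
      obtain ⟨χ, hχ⟩ := exact₂ _ h
      obtain ⟨χ, rfl⟩ := (h₂' N).2 χ
      rw [← Functor.map_comp] at hχ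
      rw [(h₁' N).1 hχ, reassoc_of% hgf, zero_comp]
    · obtain ⟨α, hα⟩ := (h₂ N).2 (F.map T.mor₂ ≫ φ)
      obtain ⟨β, rfl⟩ := Triangle.yoneda_exact₂ _ hT α ((h₁ N).1 (by
        rw [Functor.map_comp, hα, ← Functor.map_comp_assoc, hgh, Functor.map_zero, zero_comp,
          Functor.map_zero]))
      obtain ⟨χ, hχ⟩ := exact₁ (φ - F.map β) (by
        rw [Preadditive.comp_sub, ← hα, Functor.map_comp, sub_self])
      obtain ⟨χ, rfl⟩ := (h₁' N).2 χ
      exact ⟨β + T.mor₃ ≫ χ, by rw [Functor.map_add, Functor.map_comp, ← hχ, add_sub_cancel]⟩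

instance (F : C ⥤ D) [F.CommShift ℤ] [F.IsTriangulated] : (bijectiveFrom F).IsTriangulated where
  exists_zero := ⟨0, isZero_zero C, fun _ => ⟨fun _ _ _ => (isZero_zero C).eq_of_src _ _,
    fun _ => ⟨0, (F.map_isZero (isZero_zero C)).eq_of_src _ _⟩⟩⟩
  toIsTriangulatedClosed₂ := .of_isTriangulatedClosed₃

instance (F : C ⥤ D) (J : Type w) [PreservesColimitsOfShape (Discrete J) F] :
    (bijectiveFrom F).IsClosedUnderColimitsOfShape (Discrete J) where
  colimitsOfShape_le := by
    rintro M ⟨h⟩ N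
    have hF := isColimitOfPreserves F h.isColimit
    refine ⟨fun f g hfg => h.isColimit.hom_ext fun j => (h.prop_diag_obj j N).1 ?_, fun f => ?_⟩
    · rw [Functor.map_comp, Functor.map_comp, hfg]
    · choose g hg using fun j => (h.prop_diag_obj j N).2 (F.map (h.ι.app j) ≫ f)
      refine ⟨h.isColimit.desc ⟨N, Discrete.natTrans g⟩, hF.hom_ext fun j => ?_⟩
      change F.map (h.ι.app j) ≫ _ = F.map (h.ι.app j) ≫ f
      rw [← hg, ← Functor.map_comp]
      exact congrArg F.map (h.isColimit.fac _ j)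

instance (F : C ⥤ D) [F.Full] (J : Type w) [HasCoproducts.{w} C]
    [PreservesColimitsOfShape (Discrete J) F] :
    F.essImage.IsClosedUnderColimitsOfShape (Discrete J) where
  colimitsOfShape_le := by
    rintro Y ⟨h⟩
    let X (j : J) : C := (h.prop_diag_obj ⟨j⟩).witness
    let e : Discrete.functor X ⋙ F ≅ h.diag :=
      Discrete.natIso fun j => (h.prop_diag_obj j).getIso
    exact ⟨∐ X, ⟨IsColimit.coconePointsIsoOfNatIso
      (isColimitOfPreserves F (colimit.isColimit (Discrete.functor X))) h.isColimit e⟩⟩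

/-- A triangulated functor that preserves coproducts is an equivalence if it maps a localizing
generator to a localizing generator and is bijective on the morphisms out of the first one. -/
theorem isEquivalence_of_isLocalizingGenerator (F : C ⥤ D) [F.CommShift ℤ] [F.IsTriangulated]
    [HasCoproducts.{w} C] [∀ J : Type w, PreservesColimitsOfShape (Discrete J) F] {G : C}
    (hG : IsLocalizingGenerator.{w} G) (hFG : IsLocalizingGenerator.{w} (F.obj G))
    (h : bijectiveFrom F G) : F.IsEquivalence := by
  have key (M N : C) := hG (bijectiveFrom F) h M N
  have : F.Faithful := ⟨fun h => (key _ _).1 h⟩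
  have : F.Full := ⟨fun f => (key _ _).2 f⟩
  have : F.EssSurj := ⟨hFG F.essImage (F.obj_mem_essImage G)⟩
  exact {}

/-- A functor preserves coproducts if it maps a compact object `G` to a compact localizing generator
and is bijective on the morphisms out of `G`. -/
theorem preservesCoproducts_of_isCompactObj (F : C ⥤ D) [F.CommShift ℤ] [F.IsTriangulated]
    [HasCoproducts.{w} C] [HasCoproducts.{w} D] {G : C} (hG : IsCompactObj.{w} G)
    (hFG : IsCompactObj.{w} (F.obj G)) (hFG' : IsLocalizingGenerator.{w} (F.obj G))
    (h : bijectiveFrom F G) (J : Type w) : PreservesColimitsOfShape (Discrete J) F := by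
  suffices ∀ X : J → C, IsIso (sigmaComparison F X) from
    have (X : J → C) := PreservesCoproduct.of_iso_comparison F X
    preservesColimitsOfShape_of_discrete F
  refine fun X => hFG'.isIso _ fun n => ?_
  let e := (F.commShiftIso n).app G
  have hn := (bijectiveFrom F).le_shift n _ h
  have lift {Z : C} (f : (F.obj G)⟦n⟧ ⟶ F.obj Z) : ∃ g : G⟦n⟧ ⟶ Z, e.inv ≫ F.map g = f := by
    obtain ⟨g, hg⟩ := (hn Z).2 (e.hom ≫ f)
    exact ⟨g, by rw [hg, e.inv_hom_id_assoc]⟩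
  have comp_eq (s : Finset J) (g : ∀ j, G⟦n⟧ ⟶ X j) :
      (∑ j ∈ s, (e.inv ≫ F.map (g j)) ≫ Sigma.ι (fun j => F.obj (X j)) j) ≫
        sigmaComparison F X = e.inv ≫ F.map (∑ j ∈ s, g j ≫ Sigma.ι X j) := by
    simp only [Preadditive.sum_comp, Functor.map_sum, Preadditive.comp_sum, Category.assoc,
      ι_comp_sigmaComparison, Functor.map_comp]
  refine ⟨?_, fun f => ?_⟩
  · suffices ∀ f : (F.obj G)⟦n⟧ ⟶ ∐ fun j => F.obj (X j), f ≫ sigmaComparison F X = 0 → f = 0 from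
      fun f f' h => sub_eq_zero.1 (this _ (by rw [Preadditive.sub_comp, sub_eq_zero]; exact h))
    intro f hf
    obtain ⟨s, g, rfl⟩ := hFG.shift n _ (coproductIsCoproduct _) f
    choose g' hg' using fun j => lift (g j)
    obtain rfl : (fun j => e.inv ≫ F.map (g' j)) = g := funext hg'
    have h₀ : ∑ j ∈ s, g' j ≫ Sigma.ι X j = 0 := (hn _).1 (by
      rw [← cancel_epi e.inv, ← comp_eq, Functor.map_zero, comp_zero]
      exact hf)
    refine Finset.sum_eq_zero fun j hj => ?_
    have hj : g' j = 0 := by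
      rw [← sum_inj_cofanProj (coproductIsCoproduct X) s g' hj]
      exact (congrArg (· ≫ _) h₀).trans zero_comp
    change (e.inv ≫ F.map (g' j)) ≫ _ = 0
    rw [hj, Functor.map_zero, comp_zero, zero_comp]
  · obtain ⟨g, rfl⟩ := lift f
    obtain ⟨s, g, rfl⟩ := hG.shift n _ (coproductIsCoproduct X) g
    exact ⟨_, comp_eq s g⟩

end Generator

section DerivedCategory

open DGModule

variable {k : Type u} [CommRing k] {A : DGAlgebra k}

/-! ### Homogeneous components and acyclicity -/

theorem gradedProj_mem {V : Type u} [AddCommGroup V] [Module k V] {gr : ℤ → Submodule k V}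
    (h : DirectSum.IsInternal gr) (i : ℤ) (v : V) : gradedProj h i v ∈ gr i :=
  Subtype.property _

theorem exists_eq_sum_gradedProj {V : Type u} [AddCommGroup V] [Module k V] {gr : ℤ → Submodule k V}
    (h : DirectSum.IsInternal gr) (v : V) :
    ∃ s : Finset ℤ, v = ∑ i ∈ s, gradedProj h i v := by
  classical
  refine ⟨DFinsupp.support (gradedEquiv h v), ?_⟩
  have := congrArg (gradedEquiv h).symm (DirectSum.sum_support_of (gradedEquiv h v)).symm
  rw [LinearEquiv.symm_apply_apply, map_sum] at this
  refine this.trans (Finset.sum_congr rfl fun i _ => ?_)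
  exact DirectSum.coeLinearMap_lof gr i _

namespace DGModule

theorem lin_sum {M N : DGModule A} {J : Type*} (s : Finset J) (f : J → (M ⟶ N)) (m : M) :
    (∑ j ∈ s, f j).lin m = ∑ j ∈ s, (f j).lin m :=
  map_sum (AddMonoidHom.mk' (fun f : M ⟶ N => f.lin m) fun f g => lin_add f g m) f s

theorem gradedProj_d (M : DGModule A) (i : ℤ) (m : M) :
    gradedProj M.isInternal (i + 1) (M.d m) = M.d (gradedProj M.isInternal i m) := by
  refine graded_induction M.isInternal (fun j v hv => ?_) (fun v w hv hw => ?_) m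
  · by_cases h : j = i
    · subst h
      rw [gradedProj_of_mem _ (M.d_mem hv), gradedProj_of_mem _ hv]
    · rw [gradedProj_of_mem_ne _ (by omega) (M.d_mem hv), gradedProj_of_mem_ne _ h hv, map_zero]
  · rw [map_add, map_add, hv, hw, map_add, map_add]

/-- Acyclicity can be tested on homogeneous elements. -/
theorem acyclic_iff (M : DGModule A) : M.Acyclic ↔
    ∀ (i : ℤ) (m : M), m ∈ M.gr i → M.d m = 0 → ∃ m' ∈ M.gr (i - 1), M.d m' = m := by
  refine ⟨fun h i m hm hd => ?_, fun h m hd => ?_⟩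
  · obtain ⟨m', rfl⟩ := h m hd
    refine ⟨gradedProj M.isInternal (i - 1) m', gradedProj_mem _ _ _, ?_⟩
    rw [← gradedProj_d, sub_add_cancel, gradedProj_of_mem _ hm]
  · have key (i : ℤ) : ∃ m', M.d m' = gradedProj M.isInternal i m := by
      obtain ⟨m', -, hm'⟩ := h i _ (gradedProj_mem _ _ m) (by rw [← gradedProj_d, hd, map_zero])
      exact ⟨m', hm'⟩
    choose m' hm' using key
    obtain ⟨s, hs⟩ := exists_eq_sum_gradedProj M.isInternal m
    exact ⟨∑ i ∈ s, m' i, by rw [map_sum, Finset.sum_congr rfl fun i _ => hm' i, ← hs]⟩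

/-! ### Morphisms out of the DG algebra -/

variable (A) in
/-- The unit of `A`, as an element of the regular DG module. -/
def regularOne : A.regular := (1 : A)

/-- The element of `A` that underlies an element of the regular DG module. -/
def regularVal (a : A.regular) : A := a

theorem regularOne_smul (a : A.regular) : regularOne A <• regularVal a = a := one_mul (regularVal a)

/-- The `A`-linear map `a ↦ m a`. -/
def mulLeft {M : DGModule A} (m : M) : A.regular →ₗ[Aᵐᵒᵖ] M where
  toFun a := m <• regularVal a
  map_add' a b := add_smul (MulOpposite.op (regularVal a)) (MulOpposite.op (regularVal b)) m
  map_smul' c a := mul_smul c (MulOpposite.op (regularVal a)) m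

theorem mulLeft_apply {M : DGModule A} (m : M) (a : A.regular) :
    mulLeft m a = m <• regularVal a := rfl

theorem mulLeft_mem {M : DGModule A} {m : M} {n : ℤ} (hm : m ∈ M.gr n) :
    mulLeft m ∈ homDeg A.regular M n := fun i a ha => by
  have := M.smul_mem hm (show regularVal a ∈ A.gr i from ha)
  rwa [add_comm] at this

theorem d_mulLeft {M : DGModule A} {m : M} {n : ℤ} (hm : m ∈ M.gr n) (a : A.regular) :
    M.d (mulLeft m a) = mulLeft (M.d m) a + sgn n • mulLeft m (A.regular.d a) :=
  M.leibniz hm (regularVal a)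

theorem regularOne_mem : regularOne A ∈ A.regular.gr 0 := A.one_mem

theorem d_regularOne : A.regular.d (regularOne A) = 0 := by
  have := A.leibniz A.one_mem 1
  rw [mul_one, mul_one, one_mul, sgn_zero, one_smul] at this
  exact left_eq_add.1 this

/-- The morphism `A ⟶ M` which maps `1` to a cocycle of degree `0`. -/
def ofCocycle (M : DGModule A) (m : M) (hm : m ∈ M.gr 0) (hd : M.d m = 0) : A.regular ⟶ M where
  lin := mulLeft m
  map_mem {i} a ha := by
    have := mulLeft_mem hm i a ha
    rwa [add_zero] at this
  comm a := by
    rw [d_mulLeft hm, hd, mulLeft_apply, mulLeft_apply, smul_zero, zero_add, sgn_zero, one_smul]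

theorem ofCocycle_one (M : DGModule A) (m : M) (hm : m ∈ M.gr 0) (hd : M.d m = 0) :
    (ofCocycle M m hm hd).lin (regularOne A) = m := one_smul _ m

theorem linearMap_regular_ext {M : DGModule A} {f g : A.regular →ₗ[Aᵐᵒᵖ] M}
    (h : f (regularOne A) = g (regularOne A)) : f = g := LinearMap.ext fun a => by
  rw [← regularOne_smul a, map_smul, map_smul, h]

theorem regular_hom_ext {M : DGModule A} {f g : A.regular ⟶ M}
    (h : f.lin (regularOne A) = g.lin (regularOne A)) : f = g := Hom.ext (linearMap_regular_ext h)

theorem d_lin_regularOne {M : DGModule A} (f : A.regular ⟶ M) :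
    M.d (f.lin (regularOne A)) = 0 := by
  rw [← lin_d, d_regularOne, map_zero]

/-- A morphism out of `A` is null-homotopic if the cocycle that defines it is a coboundary. -/
theorem homotopic_zero_of_regular {M : DGModule A} (f : A.regular ⟶ M) {m : M}
    (hm : m ∈ M.gr (-1)) (h : M.d m = f.lin (regularOne A)) : homotopic A f 0 := by
  refine ⟨mulLeft m, mulLeft_mem (n := -1) hm, fun a => ?_⟩
  rw [d_mulLeft hm, h, lin_zero, sub_zero, mulLeft_apply, ← map_smul, regularOne_smul]
  simp [sgn]

end DGModule

/-! ### Direct sums of DG modules -/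

namespace DGModule

variable {J : Type u} (M : J → DGModule A)

/-- The direct sum of a family of DG modules. -/
def directSum : DGModule A where
  carrier := ⨁ j, M j
  isScalarTower := ⟨fun c a v => DFinsupp.ext fun j => smul_assoc c a (v j)⟩
  gr i :=
    { carrier := {v | ∀ j, v j ∈ (M j).gr i}
      zero_mem' := fun j => zero_mem _
      add_mem' := fun hv hw j => add_mem (hv j) (hw j)
      smul_mem' := fun c _ hv j => Submodule.smul_mem _ c (hv j) }
  isInternal := isInternal_of_separating (T := Unit)
    (fun v => by
      classical
      induction v using DirectSum.induction_on with
      | zero => exact zero_mem _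
      | add v w hv hw => exact add_mem hv hw
      | of j m =>
        refine graded_induction (M j).isInternal (fun i v hv => ?_) (fun v w hv hw => ?_) m
        · refine Submodule.mem_iSup_of_mem i fun l => ?_
          by_cases h : j = l
          · subst h
            rwa [DirectSum.of_eq_same]
          · rw [DirectSum.of_eq_of_ne _ _ _ (Ne.symm h)]
            exact zero_mem _
        · rw [map_add]
          exact add_mem hv hw)
    (fun _ i => DirectSum.lmap fun j => gradedProj (M j).isInternal i)
    (fun i v hv h => by
      rw [← h ⟨⟩]
      exact DFinsupp.ext fun j => (gradedProj_of_mem _ (hv j)).symm)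
    (fun _ i j hij v hv => DFinsupp.ext fun j => gradedProj_of_mem_ne _ hij (hv j))
  smul_mem hm ha j := (M j).smul_mem (hm j) ha
  d := DirectSum.lmap fun j => (M j).d
  d_mem hm j := (M j).d_mem (hm j)
  d_d m := DFinsupp.ext fun j => (M j).d_d (m j)
  leibniz hm a := DFinsupp.ext fun j => (M j).leibniz (hm j) a

/-- The projection onto a summand. -/
def directSumProj (j : J) : directSum M →ₗ[Aᵐᵒᵖ] M j := DirectSum.component Aᵐᵒᵖ J (fun j => M j) j

theorem directSumProj_mem {i : ℤ} {v : directSum M} (hv : v ∈ (directSum M).gr i) (j : J) :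
    directSumProj M j v ∈ (M j).gr i := hv j

theorem directSumProj_d (v : directSum M) (j : J) :
    directSumProj M j ((directSum M).d v) = (M j).d (directSumProj M j v) := rfl

open Classical in
/-- The inclusion of a summand. -/
def directSumInc (j : J) : M j ⟶ directSum M where
  lin := DirectSum.lof Aᵐᵒᵖ J (fun j => M j) j
  map_mem {i m} hm l := by
    by_cases h : j = l
    · subst h
      exact (DirectSum.of_eq_same (β := fun j => M j) j m).symm ▸ hm
    · exact (DirectSum.of_eq_of_ne (β := fun j => M j) j l m (Ne.symm h)).symm ▸ zero_mem _
  comm m := (DirectSum.lmap_lof (R := k) (fun j => (M j).d) j m).symm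

open Classical in
/-- The linear map out of a direct sum given by linear maps out of the summands. -/
def directSumLift {N : DGModule A} (f : ∀ j, M j →ₗ[Aᵐᵒᵖ] N) : directSum M →ₗ[Aᵐᵒᵖ] N :=
  DirectSum.toModule Aᵐᵒᵖ J N f

open Classical in
theorem directSumLift_inc {N : DGModule A} (f : ∀ j, M j →ₗ[Aᵐᵒᵖ] N) (j : J) (m : M j) :
    directSumLift M f ((directSumInc M j).lin m) = f j m :=
  DirectSum.toModule_lof (R := Aᵐᵒᵖ) (φ := f) j m

theorem exists_eq_sum_inc (v : directSum M) :
    ∃ s : Finset J, v = ∑ j ∈ s, (directSumInc M j).lin (directSumProj M j v) := by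
  classical
  exact ⟨DFinsupp.support v, (DirectSum.sum_support_of v).symm⟩

theorem directSumLift_mem {N : DGModule A} {f : ∀ j, M j →ₗ[Aᵐᵒᵖ] N} {n : ℤ}
    (hf : ∀ j, f j ∈ homDeg (M j) N n) : directSumLift M f ∈ homDeg (directSum M) N n :=
  fun i v hv => by
    obtain ⟨s, hs⟩ := exists_eq_sum_inc M v
    rw [hs, map_sum]
    refine sum_mem fun j _ => ?_
    rw [directSumLift_inc]
    exact hf j i _ (directSumProj_mem M hv j)

/-- The morphism out of a direct sum given by morphisms out of the summands. -/
def directSumDesc {N : DGModule A} (f : ∀ j, M j ⟶ N) : directSum M ⟶ N where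
  lin := directSumLift M fun j => (f j).lin
  map_mem {i} m hm := by
    have := directSumLift_mem M (fun j => lin_mem_homDeg (f j)) i m hm
    rwa [add_zero] at this
  comm v := by
    obtain ⟨s, hs⟩ := exists_eq_sum_inc M v
    rw [hs, map_sum, map_sum, map_sum, map_sum]
    refine Finset.sum_congr rfl fun j _ => ?_
    rw [← lin_d, directSumLift_inc, directSumLift_inc, lin_d]

theorem inc_directSumDesc {N : DGModule A} (f : ∀ j, M j ⟶ N) (j : J) :
    directSumInc M j ≫ directSumDesc M f = f j :=
  hom_ext fun m => directSumLift_inc M (fun j => (f j).lin) j m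

/-- Homotopies between the restrictions to the summands define a homotopy. -/
theorem homotopic_of_inc {N : DGModule A} {f g : directSum M ⟶ N}
    (h : ∀ j, homotopic A (directSumInc M j ≫ f) (directSumInc M j ≫ g)) : homotopic A f g := by
  choose h h₁ h₂ using h
  refine ⟨directSumLift M h, directSumLift_mem M (n := -1) h₁, fun v => ?_⟩
  obtain ⟨s, hs⟩ := exists_eq_sum_inc M v
  rw [hs]
  simp only [map_sum, ← Finset.sum_sub_distrib, ← Finset.sum_add_distrib]
  refine Finset.sum_congr rfl fun j _ => ?_
  rw [directSumLift_inc, ← lin_d, directSumLift_inc]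
  exact h₂ j _

end DGModule

/-- The direct sum of DG modules as a cofan in the homotopy category. -/
def cofanK {J : Type u} (X : J → HomotopyCat A) : Cofan X :=
  Cofan.mk ((toK A).obj (directSum fun j => (X j).as))
    fun j => (toK A).map (directSumInc (fun j => (X j).as) j)

/-- The direct sum of DG modules is a coproduct in the homotopy category. -/
def isColimitCofanK {J : Type u} (X : J → HomotopyCat A) : IsColimit (cofanK X) :=
  Cofan.IsColimit.mk _
    (fun c => (toK A).map (directSumDesc (N := c.pt.as) (fun j => (X j).as)
      fun j => ((toK A).map_surjective (X := (X j).as) (Y := c.pt.as) (c.inj j)).choose))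
    (fun c j => by
      refine ((toK A).map_comp _ _).symm.trans ?_
      rw [inc_directSumDesc]
      exact ((toK A).map_surjective (X := (X j).as) (Y := c.pt.as) (c.inj j)).choose_spec)
    (fun c f hf => by
      obtain ⟨f, rfl⟩ := (toK A).map_surjective (X := directSum fun j => (X j).as) (Y := c.pt.as) f
      refine toK_eq (homotopic_of_inc _ fun j => ?_)
      rw [inc_directSumDesc]
      refine (CategoryTheory.Quotient.functor_map_eq_iff (homotopic A) _ _).1 ?_
      rw [((toK A).map_surjective (X := (X j).as) (Y := c.pt.as) (c.inj j)).choose_spec]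
      exact ((toK A).map_comp _ _).trans (hf j))

instance : HasCoproducts.{u} (HomotopyCat A) := fun _ =>
  ⟨fun F =>
    have : HasColimit (Discrete.functor (F.obj ∘ Discrete.mk)) := ⟨⟨⟨_, isColimitCofanK _⟩⟩⟩
    hasColimit_of_iso Discrete.natIsoFunctor⟩

variable (A) in
/-- A morphism from `A` to a direct sum is given by a cocycle, which has finitely many non-zero
components. -/
theorem isCompactObj_regularK : IsCompactObj.{u} ((toK A).obj A.regular) :=
  isCompactObj_of_exists fun J X => by
    let M (j : J) : DGModule A := (X j).as
    refine ⟨cofanK X, ⟨isColimitCofanK X⟩, fun f => ?_⟩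
    obtain ⟨f, rfl⟩ := (toK A).map_surjective (X := A.regular) (Y := directSum M) f
    have hm : f.lin (regularOne A) ∈ (directSum M).gr 0 := lin_mem f regularOne_mem
    obtain ⟨s, hs⟩ := exists_eq_sum_inc M (f.lin (regularOne A))
    let g (j : J) : A.regular ⟶ M j := ofCocycle (M j) _ (directSumProj_mem M hm j) (by
      rw [← directSumProj_d, d_lin_regularOne, map_zero])
    refine ⟨s, fun j => (toK A).map (g j), ?_⟩
    have : f = ∑ j ∈ s, g j ≫ directSumInc M j := regular_hom_ext (by
      refine hs.trans ((Finset.sum_congr rfl fun j _ => ?_).trans (lin_sum _ _ _).symm)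
      rw [linComp, ofCocycle_one])
    rw [this, Functor.map_sum]
    exact Finset.sum_congr rfl fun j _ => (toK A).map_comp _ _

/-! ### h-projective modules -/

namespace DGModule

theorem toK_map_eq_zero {M N : DGModule A} {f : M ⟶ N} :
    (toK A).map f = 0 ↔ homotopic A f 0 := by
  rw [← (toK A).map_zero, CategoryTheory.Quotient.functor_map_eq_iff]

/-- The h-projective modules are the modules that have no non-zero morphisms to acyclic modules in
the homotopy category. -/
theorem isHProjective_iff (P : DGModule A) :
    P.IsHProjective ↔ (acyclicK A).leftOrthogonal ((toK A).obj P) := by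
  refine ⟨fun h ⟨M⟩ f hM => ?_, fun h M hM => (acyclic_iff _).2 fun n u hu hd => ?_⟩
  · obtain ⟨f, rfl⟩ := (toK A).map_surjective (X := P) (Y := M) f
    obtain ⟨v, hv, hvf⟩ := (acyclic_iff _).1 (h M hM) 0
      (⟨f.lin, homDeg_le 0 (lin_mem_homDeg f)⟩ : homTot P M) (lin_mem_homDeg f)
      (Subtype.ext (homD_lin f))
    replace hv : v.1 ∈ homDeg P M (0 - 1) := hv
    refine toK_map_eq_zero.2 ⟨v.1, fun i m hm => ?_, fun m => ?_⟩
    · have := hv i m hm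
      rwa [zero_sub, ← sub_eq_add_neg] at this
    · have h₁ : homD P M v.1 m = f.lin m := congrArg (fun w : homTot P M => w.1 m) hvf
      rw [lin_zero, sub_zero, ← h₁, homD_of_mem hv]
      simp [sgn]
  · replace hu : u.1 ∈ homDeg P M n := hu
    have hd (m : P) : M.d (u.1 m) - sgn n • u.1 (P.d m) = 0 := by
      rw [← homD_of_mem hu]
      exact congrArg (fun w : homTot P M => w.1 m) hd
    let φ : P ⟶ shiftObj M n :=
      { lin := (shiftEquiv M n).toLinearMap ∘ₗ u.1
        map_mem := fun {i m} hm => hu i m hm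
        comm := fun m => by
          change u.1 (P.d m) = sgn n • M.d (u.1 m)
          rw [sub_eq_zero.1 (hd m), sgn_smul_smul] }
    obtain ⟨h, h₁, h₂⟩ := toK_map_eq_zero.1
      (h (Y := (toK A).obj (shiftObj M n)) ((toK A).map φ) (DGModule.Acyclic.shift hM n))
    have hh : sgn n • ((shiftEquiv M n).symm.toLinearMap ∘ₗ h) ∈ homDeg P M (n - 1) :=
      fun i m hm => by
        have := shiftEquiv_symm_mem_homDeg M n _ _ (h₁ i m hm)
        rw [show i - 1 + n = i + (n - 1) by ring] at this
        exact zsmul_mem this _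
    refine ⟨(⟨_, homDeg_le _ hh⟩ : homTot P M), hh, Subtype.ext (LinearMap.ext fun m => ?_)⟩
    refine (homD_of_mem hh m).trans ?_
    have h₃ : u.1 m = sgn n • M.d ((shiftEquiv M n).symm (h m)) + (shiftEquiv M n).symm (h (P.d m)) :=
      (sub_zero (φ.lin m)).symm.trans (h₂ m)
    rw [h₃]
    change M.d (sgn n • (shiftEquiv M n).symm (h m)) -
      sgn (n - 1) • sgn n • (shiftEquiv M n).symm (h (P.d m)) = _
    rw [map_zsmul, sub_eq_add_neg n, sgn_add, mul_comm, mul_smul, sgn_smul_smul]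
    simp [sgn]

theorem regular_leftOrthogonal (A : DGAlgebra k) :
    (acyclicK A).leftOrthogonal ((toK A).obj A.regular) := by
  rintro ⟨M⟩ f hM
  obtain ⟨f, rfl⟩ := (toK A).map_surjective (X := A.regular) (Y := M) f
  obtain ⟨m, hm, hd⟩ := (acyclic_iff M).1 hM 0 _ (lin_mem f regularOne_mem) (d_lin_regularOne f)
  exact toK_map_eq_zero.2 (homotopic_zero_of_regular f hm hd)

theorem acyclic_of_hom_eq_zero {M : DGModule A}
    (h : ∀ (n : ℤ) (f : ((toK A).obj A.regular)⟦n⟧ ⟶ (toK A).obj M), f = 0) : M.Acyclic := by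
  refine (acyclic_iff M).2 fun i m hm hd => ?_
  let φ : A.regular ⟶ shiftObj M i := ofCocycle _ (shiftEquiv M i m)
    (shiftEquiv_mem.2 (by rwa [zero_add])) (by rw [shiftEquiv_d, hd, smul_zero, map_zero])
  have hφ : (toK A).map φ = 0 := by
    have := hom_shift_eq_zero h i ((toK A).map φ ≫ ((toK A).commShiftIso i).hom.app M)
    exact (cancel_mono (((toK A).commShiftIso i).hom.app M)).1 (this.trans zero_comp.symm)
  obtain ⟨h, h₁, h₂⟩ := toK_map_eq_zero.1 hφ
  have h₃ := shiftEquiv_symm_mem_homDeg M i _ _ (h₁ 0 _ regularOne_mem)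
  refine ⟨sgn i • (shiftEquiv M i).symm (h (regularOne A)), ?_, ?_⟩
  · rw [show 0 - 1 + i = i - 1 by ring] at h₃
    exact zsmul_mem h₃ _
  · have h₄ := h₂ (regularOne A)
    rw [ofCocycle_one, d_regularOne, map_zero, add_zero, lin_zero, sub_zero] at h₄
    rw [map_zsmul, ← shiftEquiv_symm_d, ← h₄, LinearEquiv.symm_apply_apply]

end DGModule

/-- Every DG module is quasi-isomorphic to a module in the localizing subcategory of the homotopy
category that is generated by `A`. -/
theorem exists_resolution (Q : ObjectProperty (HomotopyCat A)) [Q.IsTriangulated]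
    [Q.IsClosedUnderIsomorphisms] [∀ J : Type u, Q.IsClosedUnderColimitsOfShape (Discrete J)]
    (hQ : Q ((toK A).obj A.regular)) (X : HomotopyCat A) :
    ∃ (P : HomotopyCat A) (p : P ⟶ X), Q P ∧ (acyclicK A).trW p := by
  obtain ⟨P, p, hP, hp⟩ := exists_localizing_approximation Q (isCompactObj_regularK A) hQ X
  obtain ⟨Z, q, δ, hT⟩ := distinguished_cocone_triangle p
  exact ⟨P, p, hP, Z, q, δ, hT, acyclic_of_hom_eq_zero (M := Z.as) (hom_cone_eq_zero hT hp)⟩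

/-! ### The derived category -/

theorem qD_map_bijective {P : HomotopyCat A} (hP : (acyclicK A).leftOrthogonal P)
    (X : HomotopyCat A) : Function.Bijective ((qD A).map : (P ⟶ X) → _) :=
  hP.map_bijective_of_isTriangulated (qD A) X

theorem exists_qD_iso (X : DerivedCat A) : ∃ Y : HomotopyCat A, Nonempty ((qD A).obj Y ≅ X) :=
  have := Localization.essSurj (qD A) (acyclicK A).trW
  ⟨_, ⟨(qD A).objObjPreimageIso X⟩⟩

/-- Every object of the derived category is isomorphic to an h-projective module. -/
theorem exists_leftOrthogonal_iso (X : DerivedCat A) :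
    ∃ P : HomotopyCat A, (acyclicK A).leftOrthogonal P ∧ Nonempty ((qD A).obj P ≅ X) := by
  obtain ⟨Y, ⟨e⟩⟩ := exists_qD_iso X
  obtain ⟨P, p, hP, hp⟩ := exists_resolution (acyclicK A).leftOrthogonal
    (regular_leftOrthogonal A) Y
  exact ⟨P, hP, ⟨Localization.isoOfHom (qD A) _ p hp ≪≫ e⟩⟩

/-- A coproduct of h-projective modules is a coproduct in the derived category. -/
theorem isColimit_qD {J : Type u} {P : J → HomotopyCat A}
    (hP : ∀ j, (acyclicK A).leftOrthogonal (P j)) {X : J → DerivedCat A}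
    (e : ∀ j, X j ≅ (qD A).obj (P j)) : Nonempty (IsColimit
      (Cofan.mk _ fun j => (e j).hom ≫ (qD A).map ((cofanK P).inj j) : Cofan X)) := by
  have hc : (acyclicK A).leftOrthogonal (cofanK P).pt :=
    (acyclicK A).leftOrthogonal.prop_of_isColimit (isColimitCofanK P) fun j => hP j.as
  have exists_desc (s : Cofan X) : ∃ f : (qD A).obj (cofanK P).pt ⟶ s.pt,
      ∀ j, ((e j).hom ≫ (qD A).map ((cofanK P).inj j)) ≫ f = s.inj j := by
    obtain ⟨Y, ⟨i⟩⟩ := exists_qD_iso s.pt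
    choose g hg using fun j => (qD_map_bijective (hP j) Y).2 ((e j).inv ≫ s.inj j ≫ i.inv)
    refine ⟨(qD A).map (Cofan.IsColimit.desc (isColimitCofanK P) g) ≫ i.hom, fun j => ?_⟩
    have h := congrArg (qD A).map (Cofan.IsColimit.fac (isColimitCofanK P) g j)
    rw [Functor.map_comp, hg] at h
    rw [Category.assoc, reassoc_of% h]
    simp
  choose desc hdesc using exists_desc
  refine ⟨Cofan.IsColimit.mk _ desc hdesc fun s f hf => ?_⟩
  obtain ⟨Y, ⟨i⟩⟩ := exists_qD_iso s.pt
  obtain ⟨g, hg⟩ := (qD_map_bijective hc Y).2 (f ≫ i.inv)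
  obtain ⟨g', hg'⟩ := (qD_map_bijective hc Y).2 (desc s ≫ i.inv)
  rw [← cancel_mono i.inv, ← hg', ← hg]
  refine congrArg _ (Cofan.IsColimit.hom_ext (isColimitCofanK P) _ _ fun j =>
    (qD_map_bijective (hP j) Y).1 ?_)
  rw [← cancel_epi (e j).hom, Functor.map_comp, Functor.map_comp, hg', hg]
  have h := congrArg (· ≫ i.inv) ((hf j).trans (hdesc s j).symm)
  simp only [Category.assoc] at h
  exact (Category.assoc _ _ _).symm.trans h

/-- Every family in the derived category has a coproduct that is the direct sum of h-projective
modules. -/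
theorem exists_cofan {J : Type u} (X : J → DerivedCat A) : ∃ (P : J → HomotopyCat A)
    (e : ∀ j, X j ≅ (qD A).obj (P j)), Nonempty (IsColimit
      (Cofan.mk _ fun j => (e j).hom ≫ (qD A).map ((cofanK P).inj j) : Cofan X)) := by
  choose P hP e using fun j => exists_leftOrthogonal_iso (X j)
  exact ⟨P, fun j => (e j).some.symm, isColimit_qD hP _⟩

instance : HasCoproducts.{u} (DerivedCat A) := fun _ =>
  ⟨fun F =>
    have : HasColimit (Discrete.functor (F.obj ∘ Discrete.mk)) := by
      obtain ⟨P, e, ⟨h⟩⟩ := exists_cofan (F.obj ∘ Discrete.mk)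
      exact ⟨⟨⟨_, h⟩⟩⟩
    hasColimit_of_iso Discrete.natIsoFunctor⟩

variable (A) in
theorem isCompactObj_regular : IsCompactObj.{u} ((toD A).obj A.regular) :=
  isCompactObj_of_exists fun J X => by
    obtain ⟨P, e, h⟩ := exists_cofan X
    refine ⟨_, h, fun f => ?_⟩
    obtain ⟨f, rfl⟩ := (qD_map_bijective (regular_leftOrthogonal A) (cofanK P).pt).2 f
    obtain ⟨s, g, rfl⟩ := isCompactObj_regularK A _ (isColimitCofanK P) f
    refine ⟨s, fun j => (qD A).map (g j) ≫ (e j).inv, ?_⟩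
    rw [Functor.map_sum]
    refine Finset.sum_congr rfl fun j _ => ?_
    change _ = ((qD A).map (g j) ≫ (e j).inv) ≫ (e j).hom ≫ (qD A).map ((cofanK P).inj j)
    rw [Category.assoc, Iso.inv_hom_id_assoc, Functor.map_comp]

variable (A) in
theorem isLocalizingGenerator_regular : IsLocalizingGenerator.{u} ((toD A).obj A.regular) := by
  intro Q _ _ _ hQ X
  let QK := (acyclicK A).leftOrthogonal ⊓ Q.inverseImage (qD A)
  have (J : Type u) : QK.IsClosedUnderColimitsOfShape (Discrete J) :=
    ⟨by
      rintro X ⟨h⟩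
      let P (j : J) : HomotopyCat A := h.diag.obj ⟨j⟩
      obtain ⟨hc⟩ := isColimit_qD (P := P) (fun j => (h.prop_diag_obj ⟨j⟩).1) fun j => Iso.refl _
      have e : X ≅ (cofanK P).pt :=
        h.isColimit.coconePointsIsoOfNatIso (isColimitCofanK P) Discrete.natIsoFunctor
      exact ⟨(acyclicK A).leftOrthogonal.prop_of_isColimit h.isColimit
        fun j => (h.prop_diag_obj j).1, Q.prop_of_iso ((qD A).mapIso e.symm)
        (Q.prop_of_isColimit hc fun j => (h.prop_diag_obj j).2)⟩⟩
  obtain ⟨Y, ⟨e⟩⟩ := exists_qD_iso X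
  obtain ⟨P, p, hP, hp⟩ := exists_resolution QK ⟨regular_leftOrthogonal A, hQ⟩ Y
  exact Q.prop_of_iso (Localization.isoOfHom (qD A) _ p hp ≪≫ e) hP.2

/-! ### The functor `RHom(P, -)` -/

namespace DGModule

/-- The DG module `Hom(P, P)` is the regular module over the endomorphism algebra. -/
def homSelfIso (P : DGModule A) : homDG P P ≅ (endDG P).regular :=
  isoOfEq _ _
    { toFun := fun f => f, invFun := fun f => f, left_inv := fun _ => rfl,
      right_inv := fun _ => rfl, map_add' := fun _ _ => rfl, map_smul' := fun _ _ => rfl }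
    (fun _ _ => Iff.rfl) (fun _ => rfl)

/-- The identity of `P`, as an element of `Hom(P, P)`. -/
def homId (P : DGModule A) : homDG P P :=
  (⟨LinearMap.id, homDeg_le 0 (id_mem_homDeg P)⟩ : homTot P P)

theorem homId_mem (P : DGModule A) : homId P ∈ (homDG P P).gr 0 := id_mem_homDeg P

theorem d_homId (P : DGModule A) : (homDG P P).d (homId P) = 0 := homTot_ext fun p => by
  refine (homD_of_mem (id_mem_homDeg P) p).trans ?_
  rw [sgn_zero, one_smul]
  exact sub_self _

theorem lin_eq_comp {P N : DGModule A} (ψ : homDG P P ⟶ homDG P N) (w : homDG P P) :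
    (ψ.lin w).1 = (ψ.lin (homId P)).1 ∘ₗ w.1 :=
  congrArg (fun v : homTot P N => v.1)
    (map_smul ψ.lin (MulOpposite.op (regularVal ((homSelfIso P).hom.lin w))) (homId P))

end DGModule

/-- A morphism of DG modules `Hom(P, P) ⟶ Hom(P, N)` is the composition with its value at the
identity; this applies to homotopies as well. -/
theorem homK_map_bijective (P N : DGModule A) : Function.Bijective
    ((homK P).map : ((toK A).obj P ⟶ (toK A).obj N) → _) := by
  refine ⟨fun f g hfg => ?_, fun ψ => ?_⟩
  · obtain ⟨f, rfl⟩ := (toK A).map_surjective f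
    obtain ⟨g, rfl⟩ := (toK A).map_surjective g
    obtain ⟨h, h₁, h₂⟩ := (CategoryTheory.Quotient.functor_map_eq_iff (homotopic (endDG P))
      (homMap P f) (homMap P g)).1 hfg
    have hv : (h (homId P)).1 ∈ homDeg P N (0 - 1) := h₁ 0 _ (homId_mem P)
    refine toK_eq ⟨(h (homId P)).1, fun i m hm => ?_, fun m => ?_⟩
    · have := hv i m hm
      rwa [zero_sub, ← sub_eq_add_neg] at this
    · have h₃ := h₂ (homId P)
      rw [d_homId, map_zero, add_zero] at h₃
      refine (congrArg (fun w : homTot P N => w.1 m) h₃).trans ?_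
      refine (homD_of_mem hv m).trans ?_
      simp [sgn]
  · obtain ⟨ψ, rfl⟩ := (toK (endDG P)).map_surjective (X := homDG P P) (Y := homDG P N) ψ
    have hu : (ψ.lin (homId P)).1 ∈ homDeg P N 0 := lin_mem ψ (homId_mem P)
    have hd : (homDG P N).d (ψ.lin (homId P)) = 0 := by rw [← lin_d, d_homId, map_zero]
    let f : P ⟶ N :=
      { lin := (ψ.lin (homId P)).1
        map_mem := fun {i m} hm => by
          have := hu i m hm
          rwa [add_zero] at this
        comm := fun m => by
          have := (homD_of_mem hu m).symm.trans (congrArg (fun w : homTot P N => w.1 m) hd)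
          rw [sgn_zero, one_smul] at this
          exact (sub_eq_zero.1 this).symm }
    exact ⟨(toK A).map f, congrArg (toK (endDG P)).map
      (hom_ext fun w => Subtype.ext (lin_eq_comp ψ w).symm)⟩

theorem bijectiveFrom_RHom (P : DGModule A) (hP : P.IsHProjective) :
    bijectiveFrom (RHom P hP) ((toD A).obj P) := fun N => by
  obtain ⟨⟨Y⟩, ⟨e⟩⟩ := exists_qD_iso N
  refine bijective_map_of_iso _ ?_ (Iso.refl _) e
  have h : (acyclicK (endDG P)).leftOrthogonal ((homK P).obj ((toK A).obj P)) :=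
    ObjectProperty.prop_of_iso _ ((toK (endDG P)).mapIso (homSelfIso P).symm)
      (regular_leftOrthogonal (endDG P))
  have h₁ : Function.Bijective ((homK P ⋙ qD (endDG P)).map :
      ((toK A).obj P ⟶ (toK A).obj Y) → _) :=
    (qD_map_bijective h _).comp (homK_map_bijective P Y)
  exact (Function.Bijective.of_comp_iff _ (qD_map_bijective ((isHProjective_iff P).1 hP) _)).1
    (bijective_map_of_natIso (RHomIso P hP).symm h₁)

/-- The image of `P` by `RHom(P, -)` is the DG algebra of endomorphisms of `P`. -/
def RHomSelfIso (P : DGModule A) (hP : P.IsHProjective) :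
    (RHom P hP).obj ((toD A).obj P) ≅ (toD (endDG P)).obj (endDG P).regular :=
  (RHomIso P hP).app ((toK A).obj P) ≪≫ (toD (endDG P)).mapIso (homSelfIso P)

end DerivedCategory

end

/-! ### The equivalence -/

theorem proposition3p3 {k : Type u} [Field k] (A B : DGAlgebra k)
    (πup : DerivedCat A ⥤ DerivedCat B) (πlow : DerivedCat B ⥤ DerivedCat A)
    [πup.CommShift ℤ] [πup.IsTriangulated] [πlow.CommShift ℤ] [πlow.IsTriangulated]
    (adj : πup ⊣ πlow)
    (h₁ : Nonempty (πup ⋙ πlow ≅ 𝟭 (DerivedCat A)))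
    (h₂ : ∀ J : Type u, PreservesColimitsOfShape (Discrete J) πup ∧
      PreservesColimitsOfShape (Discrete J) πlow)
    (h₃ : ∀ (E : DerivedCat A) (F : DerivedCat B), Perf A E → Perf B F →
      Module.Finite k (⨁ n : ℤ, (πup.obj E ⟶ F⟦n⟧))) :
    (∃ P : DGModule B, P.IsHProjective ∧
      Nonempty ((toD B).obj P ≅ πup.obj ((toD A).obj A.regular))) ∧
    ∀ (P : DGModule B) (hP : P.IsHProjective),
      Nonempty ((toD B).obj P ≅ πup.obj ((toD A).obj A.regular)) →
        (πup ⋙ RHom P hP).IsEquivalence ∧ (πup ⋙ RHom P hP).IsTriangulated := by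
  refine ⟨?_, fun P hP ⟨e⟩ => ⟨?_, inferInstance⟩⟩
  · obtain ⟨⟨P⟩, hP, h⟩ := exists_leftOrthogonal_iso (πup.obj ((toD A).obj A.regular))
    exact ⟨P, (DGModule.isHProjective_iff P).2 hP, h⟩
  · obtain ⟨i⟩ := h₁
    have hπ : πup.FullyFaithful := adj.fullyFaithfulLOfCompIsoId i
    have hT : IsCompactObj.{u} ((toD B).obj P) :=
      ((isCompactObj_regular A).of_adjunction adj fun J => (h₂ J).2).of_iso e.symm
    have e₁ := RHomSelfIso P hP
    have hcop := preservesCoproducts_of_isCompactObj (RHom P hP) hT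
      ((isCompactObj_regular (DGModule.endDG P)).of_iso e₁.symm)
      ((isLocalizingGenerator_regular (DGModule.endDG P)).of_iso e₁.symm) (bijectiveFrom_RHom P hP)
    have (J : Type u) : PreservesColimitsOfShape (Discrete J) (πup ⋙ RHom P hP) :=
      have := (h₂ J).1
      have := hcop J
      inferInstance
    refine isEquivalence_of_isLocalizingGenerator _ (isLocalizingGenerator_regular A)
      ((isLocalizingGenerator_regular (DGModule.endDG P)).of_iso
        (e₁.symm ≪≫ (RHom P hP).mapIso e)) fun N => ?_
    exact ((bijectiveFrom (RHom P hP)).prop_of_iso e (bijectiveFrom_RHom P hP) _).comp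
      (hπ.map_bijective _ _)
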